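/- **Theorem 2.1.1.** *Conventions.* Let $Z=(Z_1,\dots,Z_N)$, $\zeta=(\zeta_1,\dots,\zeta_N)$; for a formal power series $f$, $\bar f$ denotes the series with complex conjugated coefficients. A *formal generic submanifold* $M$ of $\mathbb C^N$ through $0$ of codimension $d$ is given by a defining series $\rho=(\rho_1,\dots,\rho_d)\in\mathbb C[[Z,\zeta]]^d$ with $\rho(Z,\zeta)=\bar\rho(\zeta,Z)$, $\rho(0)=0$ and $\partial_Z\rho_1(0)\wedge\dots\wedge\partial_Z\rho_d(0)\ne0$; two series $\rho,\tilde\rho$ define the same $M$ if $\rho=a\tilde\rho$ for a $d\times d$ matrix $a$ over $\mathbb C[[Z,\zeta]]$. A formal vector field $X=\sum_j(a_j\,\partial/\partial Z_j+b_j\,\partial/\partial\zeta_j)$, $a_j,b_j\in\mathbb C[[Z,\zeta]]$, is of type $(1,0)$ if all $b_j=0$, of type $(0,1)$ if all $a_j=0$, and tangent to $M$ if $X\rho=a\rho$ for some $d\times d$ matrix $a$ over $\mathbb C[[Z,\zeta]]$. Let $\mathcal D_M$ be the $\mathbb C[[Z,\zeta]]$-module generated by the $(1,0)$ and $(0,1)$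 vector fields tangent to $M$, $\mathfrak g_M$ the complex Lie algebra generated by $\mathcal D_M$, and $\mathcal D_M(0)\subset\mathfrak g_M(0)\subset\mathbb C^{2N}$ the spaces obtained by evaluating coefficients at $0$. $M$ is of *finite type* at $0$ if $\dim_{\mathbb C}\mathfrak g_M(0)=2N-d$. $M$ is *$\ell_0$-nondegenerate* at $0$ if $\ell_0$ is the smallest integer $\ell\ge0$ with $$\operatorname{span}\{L^\alpha(\partial\rho_j/\partial Z)(0):1\le j\le d,\ |\alpha|\le\ell\}=\mathbb C^N,$$ where $L=(L_1,\dots,L_{N-d})$ is a basis of the $(0,1)$ vector fields tangent to $M$ modulo those with coefficients in the ideal $(\rho_1,\dots,\rho_d)$ and $L^\alpha=L_1^{\alpha_1}\cdots L_{N-d}^{\alpha_{N-d}}$ (this does not depend on the choices of $L$ and $\rho$). Let $M'\subset\mathbb C^{N'}$ be a formal generic submanifold of codimension $d'$ with defining series $\rho'$. A formal mapping $H\in\mathbb C[[Z]]^{N'}$ with $H(0)=0$ maps $(M,0)$ to $(M',0)$ if $\rho'(H(Z),\bar H(\zeta))=c(Z,\zeta)\rho(Z,\zeta)$ for some $d'\times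 d$ matrix $c$ over $\mathbb C[[Z,\zeta]]$; it is then *CR submersive* if the differential $d\mathcal H$ at $0$ of $\mathcal H(Z,\zeta)=(H(Z),\bar H(\zeta))$ satisfies $d\mathcal H(\mathcal D_M(0))=\mathcal D_{M'}(0)$. *Statement.* Let $M$ be a formal generic submanifold of $\mathbb C^N$ through $0$ of codimension $d\ge1$ which is of finite type at $0$. Then there is an integer $k_0$ with $1<k_0\le d+1$, depending only on $M$, such that the following holds. Let $M'$ be any formal generic submanifold of any $\mathbb C^{N'}$ through $0$ which is $\ell_0$-nondegenerate at $0$ for some integer $\ell_0$. If $H^1,H^2\colon(M,0)\to(M',0)$ are CR submersive formal mappings such that $$\frac{\partial^{|\alpha|}H^1}{\partial Z^\alpha}(0)=\frac{\partial^{|\alpha|}H^2}{\partial Z^\alpha}(0)\qquad\text{for all }\alpha\text{ with }|\alpha|\le k_0\ell_0,$$ then $H^1=H^2$. -/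

import Mathlib

noncomputable section

namespace FormalCR

/-- The ring `ℂ[[Z, ζ]]`, `Z = (Z₁, …, Z_N)`, `ζ = (ζ₁, …, ζ_N)`; the variable `Z_i` is indexed by
`Sum.inl i` and the variable `ζ_i` by `Sum.inr i`. -/
abbrev Series (N : ℕ) : Type := MvPowerSeries (Fin N ⊕ Fin N) ℂ

/-- The series `f̄`, obtained by conjugating each coefficient of `f`. -/
def conjSeries {σ : Type} (f : MvPowerSeries σ ℂ) : MvPowerSeries σ ℂ :=
  MvPowerSeries.map (starRingEnd ℂ) f

/-- The series `f(ζ, Z)`. -/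
def swapSeries {N : ℕ} (f : Series N) : Series N :=
  MvPowerSeries.rename Sum.swap f

/-- The composition of operators `D₁ ^ α₁ ∘ ⋯ ∘ D_n ^ α_n` (in this order; `D_n` acts first). -/
def multiPow {A : Type} {n : ℕ} (D : Fin n → A → A) (α : Fin n → ℕ) : A → A :=
  ((List.finRange n).map fun i => (D i)^[α i]).foldr (fun f g => f ∘ g) id

/-- The iterated partial derivative `∂^|α| f / ∂Z^α` of `f ∈ ℂ[[Z₁, …, Z_N]]`. -/
def partialDeriv {N : ℕ} (α : Fin N → ℕ) (f : MvPowerSeries (Fin N) ℂ) :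
    MvPowerSeries (Fin N) ℂ :=
  multiPow (fun i g => MvPowerSeries.pderiv ℂ i g) α f

/-- A formal generic submanifold of `ℂ^N` through `0` of codimension `d`, given by a defining
series `ρ = (ρ₁, …, ρ_d)`. Two of these are the same submanifold if they are related by
`SameSubmanifold` below. -/
structure GenericSubmanifold (N d : ℕ) where
  /-- the defining series -/
  ρ : Fin d → Series N
  /-- the reality condition `ρ(Z, ζ) = ρ̄(ζ, Z)` -/
  real : ∀ j, ρ j = swapSeries (conjSeries (ρ j))
  /-- `ρ(0) = 0` -/
  zero : ∀ j, MvPowerSeries.constantCoeff (ρ j) = 0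
  /-- `∂_Z ρ₁(0) ∧ ⋯ ∧ ∂_Z ρ_d(0) ≠ 0` -/
  generic : LinearIndependent ℂ fun (j : Fin d) (i : Fin N) =>
    MvPowerSeries.constantCoeff (MvPowerSeries.pderiv ℂ (Sum.inl i) (ρ j))

/-- Equality of formal submanifolds: `ρ = a ρ₁` for a `d × d` matrix `a` of formal power series. -/
def SameSubmanifold {N d : ℕ} (M M₁ : GenericSubmanifold N d) : Prop :=
  ∃ a : Matrix (Fin d) (Fin d) (Series N), M.ρ = a.mulVec M₁.ρ

/-- A formal vector field `∑ (a_j ∂/∂Z_j + b_j ∂/∂ζ_j)`, given by its coefficients: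
`a_j` is the value at `Sum.inl j` and `b_j` the value at `Sum.inr j`. -/
abbrev VectorField (N : ℕ) : Type := Fin N ⊕ Fin N → Series N

/-- A formal vector field as a derivation of `ℂ[[Z, ζ]]`. -/
def VectorField.toDerivation {N : ℕ} (X : VectorField N) :
    Derivation ℂ (Series N) (Series N) :=
  ∑ s, X s • MvPowerSeries.pderiv ℂ s

/-- Type `(1,0)`: all `b_j` vanish. -/
def VectorField.IsType10 {N : ℕ} (X : VectorField N) : Prop := ∀ j, X (Sum.inr j) = 0

/-- Type `(0,1)`: all `a_j` vanish. -/
def VectorField.IsType01 {N : ℕ} (X : VectorField N) : Prop := ∀ j, X (Sum.inl j) = 0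

/-- Evaluation at `0` of the coefficients of a vector field, the vector field being given as a
derivation `D`: its coefficients are the series `D(Z_j)`, `D(ζ_j)`. -/
def evalZero (N : ℕ) : Derivation ℂ (Series N) (Series N) →ₗ[ℂ] (Fin N ⊕ Fin N → ℂ) where
  toFun D s := MvPowerSeries.constantCoeff (D (MvPowerSeries.X s))
  map_add' D E := by
    funext s
    simp
  map_smul' c D := by
    funext s
    simp

namespace GenericSubmanifold

variable {N d : ℕ} (M : GenericSubmanifold N d)

/-- `X` is tangent to `M`: `Xρ = a ρ` for some `d × d` matrix `a` of formal power series. -/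
def Tangent (X : VectorField N) : Prop :=
  ∃ a : Matrix (Fin d) (Fin d) (Series N), (fun j => X.toDerivation (M.ρ j)) = a.mulVec M.ρ

/-- The `ℂ[[Z, ζ]]`-module `𝒟_M` generated by the `(0,1)` and `(1,0)` vector fields tangent
to `M`. -/
def distribution : Submodule (Series N) (VectorField N) :=
  Submodule.span (Series N) {X | M.Tangent X ∧ (X.IsType01 ∨ X.IsType10)}

/-- The complex Lie algebra `𝔤_M` generated by `𝒟_M`. -/
def lieAlgebra : LieSubalgebra ℂ (Derivation ℂ (Series N) (Series N)) :=
  LieSubalgebra.lieSpan ℂ _ {D | ∃ X ∈ M.distribution, X.toDerivation = D}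

/-- `𝔤_M(0)`. -/
def lieAlgebraAtZero : Submodule ℂ (Fin N ⊕ Fin N → ℂ) :=
  M.lieAlgebra.toSubmodule.map (evalZero N)

/-- `𝒟_M(0)`; the vectors that arise by evaluating the coefficients of the members of `𝒟_M`
at `0` form a subspace. -/
def distributionAtZero : Submodule ℂ (Fin N ⊕ Fin N → ℂ) where
  carrier := {v | ∃ X ∈ M.distribution, v = fun s => MvPowerSeries.constantCoeff (X s)}
  add_mem' := by
    rintro _ _ ⟨X, hX, rfl⟩ ⟨Y, hY, rfl⟩
    exact ⟨X + Y, add_mem hX hY, by funext s; simp⟩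
  zero_mem' := ⟨0, zero_mem _, by funext s; simp⟩
  smul_mem' := by
    rintro c _ ⟨X, hX, rfl⟩
    exact ⟨(MvPowerSeries.C c : Series N) • X, Submodule.smul_mem _ _ hX, by funext s; simp⟩

/-- `M` is of finite type at `0`: `dim 𝔤_M(0) = 2 N - d`. -/
def FiniteType : Prop := Module.finrank ℂ M.lieAlgebraAtZero + d = 2 * N

/-- The ideal generated by `ρ₁, …, ρ_d`. -/
def ideal : Ideal (Series N) := Ideal.span (Set.range M.ρ)

/-- `L₁, …, L_n` is a basis of the `(0,1)` vector fields tangent to `M`, modulo those whose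
coefficients are in the ideal generated by `ρ`. -/
structure IsCRBasis {n : ℕ} (L : Fin n → VectorField N) : Prop where
  type01 : ∀ k, (L k).IsType01
  tangent : ∀ k, M.Tangent (L k)
  spanning : ∀ X : VectorField N, X.IsType01 → M.Tangent X →
    ∃ c : Fin n → Series N, ∀ s, (X - ∑ k, c k • L k) s ∈ M.ideal
  independent : ∀ c : Fin n → Series N,
    (∀ s, (∑ k, c k • L k) s ∈ M.ideal) → ∀ k, c k ∈ M.ideal

/-- The span of the vectors `L^α(∂ρ_j/∂Z)(0)`, `1 ≤ j ≤ d`, `|α| ≤ ℓ`, in `ℂ^N`. -/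
def gradientSpan {n : ℕ} (L : Fin n → VectorField N) (l : ℕ) : Submodule ℂ (Fin N → ℂ) :=
  Submodule.span ℂ {v | ∃ (j : Fin d) (α : Fin n → ℕ), ∑ k, α k ≤ l ∧
    v = fun i => MvPowerSeries.constantCoeff
      (multiPow (fun k f => (L k).toDerivation f) α
        (MvPowerSeries.pderiv ℂ (Sum.inl i) (M.ρ j)))}

/-- `M` is `ℓ₀`-nondegenerate at `0`: `ℓ₀` is the smallest integer `ℓ ≥ 0` for which the vectors
`L^α(∂ρ_j/∂Z)(0)`, `|α| ≤ ℓ`, span `ℂ^N`. This does not depend on the basis `L`. -/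
def Nondegenerate (l₀ : ℕ) : Prop :=
  ∃ L : Fin (N - d) → VectorField N, M.IsCRBasis L ∧
    IsLeast {l : ℕ | M.gradientSpan L l = ⊤} l₀

end GenericSubmanifold

/-- A formal mapping `(ℂ^N, 0) → (ℂ^N', 0)`. -/
@[ext]
structure FormalMap (N N' : ℕ) where
  /-- the components -/
  comp : Fin N' → MvPowerSeries (Fin N) ℂ
  /-- there are no constant terms -/
  zero : ∀ j, MvPowerSeries.constantCoeff (comp j) = 0

namespace FormalMap

variable {N N' d d' : ℕ} (H : FormalMap N N')

/-- The associated mapping `ℋ(Z, ζ) = (H(Z), H̄(ζ))`. -/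
def complexify : Fin N' ⊕ Fin N' → Series N
  | Sum.inl j => MvPowerSeries.rename Sum.inl (H.comp j)
  | Sum.inr j => MvPowerSeries.rename Sum.inr (conjSeries (H.comp j))

/-- `H` maps `M` into `M'`: `ρ'(H(Z), H̄(ζ)) = c(Z, ζ) ρ(Z, ζ)` for some `d' × d` matrix `c` of
formal power series. -/
def MapsInto (M : GenericSubmanifold N d) (M' : GenericSubmanifold N' d') : Prop :=
  ∃ c : Matrix (Fin d') (Fin d) (Series N),
    (fun k => MvPowerSeries.subst H.complexify (M'.ρ k)) = c.mulVec M.ρ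

/-- The tangent mapping `dℋ` at `0`. -/
def tangentMap : (Fin N ⊕ Fin N → ℂ) →ₗ[ℂ] (Fin N' ⊕ Fin N' → ℂ) :=
  Matrix.mulVecLin (Matrix.of fun t s =>
    MvPowerSeries.constantCoeff (MvPowerSeries.pderiv ℂ s (H.complexify t)))

/-- `H` is a CR submersive formal mapping `(M, 0) → (M', 0)`: it maps `M` into `M'`, and
`dℋ(𝒟_M(0)) = 𝒟_{M'}(0)`. -/
def CRSubmersive (M : GenericSubmanifold N d) (M' : GenericSubmanifold N' d') : Prop :=
  H.MapsInto M M' ∧ M.distributionAtZero.map H.tangentMap = M'.distributionAtZero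

end FormalMap

end FormalCR

end

noncomputable section

open MvPowerSeries IsLocalRing

namespace FormalCR

/-! ### Ideals of Noetherian local rings are closed. -/

section General

variable {R : Type*} [CommRing R] [IsLocalRing R] [IsNoetherianRing R]

/-! Write `I` for the ideal of `M` and `δ = H¹ - H²`. The iterated Segre sets are replaced by ideals
in the variables `Z`: `S₀` is the maximal ideal, and `S_{k+1}` consists of the `f` with `f(Z) ∈ I +
(ḡ(ζ) : g ∈ S_k)`. The proof shows that `S_{d+1} = 0` and that `δ` lies in `S_{d+1}`, so `k₀ = d +
1` works.

Vanishing (`segreIdeal_eq_bot`). The `S_k` are prime and decreasing. If `S_k = S_{k+1}`, then `I +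
S̄_k(ζ) = I + S_k(Z)`. Fields of type `(0,1)` kill functions of `Z`, and fields of type `(1,0)` kill
functions of `ζ`; so both kinds preserve this ideal when they are tangent to `M`, and hence so does
all of `𝔤_M`. By finite type, `𝔤_M` realizes every vector tangent to `M` at `0`, so elements of the
ideal vanish on `M` to infinite order, that is, the ideal is `I` (`le_ideal_of_finiteType`). No
nonzero function of `Z` alone lies in `I`, so `S_k = 0`. Thus the chain drops strictly until it
reaches `0`. Since `S₁` is generated by the `d` series `ρ_j(Z, 0)`, its height is at most `d`, and
`S_{d+1} = 0`.

Reflection (`holo_sub_mem`). Subtracting `ρ'(H²,H̄²)` from `ρ'(H¹,H̄¹)` gives relations `∑ A_{ji}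
δ_i(Z) ∈ I + (δ̄(ζ))`, where `A_{ji}` is `∂ρ'_j/∂Z_i` along `H¹` up to terms in the ideal of `Z`. CR
submersivity lifts the `(0,1)` directions of `M'` to tangent fields on `M`; these do not see `δ(Z)`
and differentiate only the `A_{ji}`. By `ℓ₀`-nondegeneracy, at most `ℓ₀` derivatives yield
coefficient vectors spanning at `0`, and Nakayama's lemma puts `δ_i(Z)` in `I` plus the conjugate
`ℓ₀`-jet of `δ`.

Iteration (`applyWord_pderiv_mem_segreIdeal`). Differentiating in `Z` along `M`, derivatives of `δ`
of order at most `(k₀-k)ℓ₀` lie in `S_k`. The jet hypothesis is the case `k = 0`. -/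

theorem mem_of_forall_mem_sup_pow {q : Ideal R} {x : R}
    (h : ∀ r : ℕ, x ∈ q ⊔ maximalIdeal R ^ r) : x ∈ q := by
  by_cases hq : q = ⊤
  · simp [hq]
  have : Nontrivial (R ⧸ q) := Ideal.Quotient.nontrivial_iff.2 hq
  have : IsLocalRing (R ⧸ q) :=
    IsLocalRing.of_surjective' (Ideal.Quotient.mk q) Ideal.Quotient.mk_surjective
  -- Krull's intersection theorem in the local ring `R ⧸ q`.
  have key : ⨅ i : ℕ, ((maximalIdeal R).map (Ideal.Quotient.mk q)) ^ i = ⊥ := by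
    apply Ideal.iInf_pow_eq_bot_of_isLocalRing
    intro htop
    have h1 := (Ideal.eq_top_iff_one _).1 htop
    rw [Ideal.mem_map_iff_of_surjective _ Ideal.Quotient.mk_surjective] at h1
    obtain ⟨y, hy, hy1⟩ := h1
    rw [← map_one (Ideal.Quotient.mk q), Ideal.Quotient.eq] at hy1
    have h2 := Ideal.sub_mem _ hy (IsLocalRing.le_maximalIdeal hq hy1)
    rw [sub_sub_cancel] at h2
    exact (Ideal.ne_top_iff_one _).1 (maximalIdeal.isMaximal R).ne_top h2
  rw [← Ideal.Quotient.eq_zero_iff_mem, ← Ideal.mem_bot, ← key, Ideal.mem_iInf]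
  intro r
  obtain ⟨a, ha, b, hb, rfl⟩ := Submodule.mem_sup.1 (h r)
  rw [map_add, Ideal.Quotient.eq_zero_iff_mem.2 ha, zero_add, ← Ideal.map_pow]
  exact Ideal.mem_map_of_mem _ hb

end General

/-! ### First-order expansions of formal power series. -/

section PowerSeries

variable {σ : Type} [Fintype σ]

theorem mem_maximalIdeal_iff {σ : Type} {f : MvPowerSeries σ ℂ} :
    f ∈ maximalIdeal (MvPowerSeries σ ℂ) ↔ constantCoeff f = 0 := by
  rw [IsLocalRing.mem_maximalIdeal, mem_nonunits_iff, MvPowerSeries.isUnit_iff_constantCoeff,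
    isUnit_iff_ne_zero, not_not]

/-- Each nonzero exponent is assigned to one variable occurring in it; `g s` collects the monomials
assigned to `s`, divided by `X s`. -/
theorem exists_eq_sum_X_mul {f : MvPowerSeries σ ℂ} (hf : constantCoeff f = 0) :
    ∃ g : σ → MvPowerSeries σ ℂ, f = ∑ s, X s * g s := by
  classical
  have hch : ∀ e : σ →₀ ℕ, ∃ o : Option σ, (e ≠ 0 → ∃ s, o = some s ∧ e s ≠ 0) := by
    intro e
    by_cases he : e = 0
    · exact ⟨none, fun h => absurd he h⟩
    · obtain ⟨s, hs⟩ := Finsupp.ne_iff.1 he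
      exact ⟨some s, fun _ => ⟨s, rfl, by simpa using hs⟩⟩
  choose c hc using hch
  refine ⟨fun s n => if c (n + Finsupp.single s 1) = some s then
    coeff (n + Finsupp.single s 1) f else 0, ?_⟩
  ext e
  rw [map_sum]
  have hterm : ∀ s, coeff e (X s * (show MvPowerSeries σ ℂ from fun n =>
      if c (n + Finsupp.single s 1) = some s then coeff (n + Finsupp.single s 1) f else 0)) =
      if c e = some s ∧ e s ≠ 0 then coeff e f else 0 := by
    intro s
    rw [X_def, coeff_monomial_mul]
    by_cases hs : e s = 0
    · rw [if_neg, if_neg]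
      · simp [hs]
      · intro h
        have := h s
        simp [hs] at this
    · have hle : Finsupp.single s 1 ≤ e := by
        rw [Finsupp.single_le_iff]
        omega
      rw [if_pos hle, one_mul]
      change (if c (e - _ + _) = some s then coeff (e - _ + _) f else 0) = _
      rw [tsub_add_cancel_of_le hle]
      simp [hs]
  refine Eq.trans ?_ (Finset.sum_congr rfl fun s _ => (hterm s).symm)
  by_cases he : e = 0
  · subst he
    simpa using hf
  · obtain ⟨s, hs, hes⟩ := hc e he
    rw [Finset.sum_eq_single s]
    · simp [hs, hes]
    · intro t _ ht
      rw [if_neg]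
      rintro ⟨h, -⟩
      rw [hs] at h
      exact ht (Option.some_injective _ h).symm
    · simp

theorem maximalIdeal_eq_span :
    maximalIdeal (MvPowerSeries σ ℂ) = Ideal.span (Set.range X) := by
  apply le_antisymm
  · intro f hf
    obtain ⟨g, rfl⟩ := exists_eq_sum_X_mul (mem_maximalIdeal_iff.1 hf)
    exact sum_mem fun s _ => Ideal.mul_mem_right _ _ (Ideal.subset_span ⟨s, rfl⟩)
  · rw [Ideal.span_le]
    rintro _ ⟨s, rfl⟩
    exact mem_maximalIdeal_iff.2 (by simp)

/-- An additive map that kills the constants and is linear over the variables, modulo a closed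
ideal `q`, takes its values in `q`. -/
theorem mem_of_map_X_mul {S : Type*} [CommRing S] [IsLocalRing S] [IsNoetherianRing S]
    {q : Ideal S} (E : MvPowerSeries σ ℂ → S) (t : σ → S) (ht : ∀ s, t s ∈ maximalIdeal S)
    (hadd : ∀ f g, E (f + g) - (E f + E g) ∈ q) (hC : ∀ c, E (C c) ∈ q)
    (hX : ∀ s g, E (X s * g) - t s * E g ∈ q) (f : MvPowerSeries σ ℂ) : E f ∈ q := by
  classical
  apply mem_of_forall_mem_sup_pow
  intro r
  -- Each variable pulled out of `f` contributes a factor `t s` in the maximal ideal, so one more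
  -- power is gained per step.
  induction r generalizing f with
  | zero => simp
  | succ r ih =>
    have hadd' : ∀ f g, E f ∈ q ⊔ maximalIdeal S ^ (r + 1) → E g ∈ q ⊔ maximalIdeal S ^ (r + 1) →
        E (f + g) ∈ q ⊔ maximalIdeal S ^ (r + 1) := by
      intro f g hf hg
      have := add_mem (Ideal.mem_sup_left (hadd f g)) (add_mem hf hg)
      simpa using this
    obtain ⟨g, hg⟩ := exists_eq_sum_X_mul (f := f - C (constantCoeff f)) (by simp)
    have hsum : ∀ T : Finset σ, E (∑ s ∈ T, X s * g s) ∈ q ⊔ maximalIdeal S ^ (r + 1) := by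
      intro T
      induction T using Finset.induction_on with
      | empty =>
        rw [Finset.sum_empty, ← map_zero (C (σ := σ) (R := ℂ))]
        exact Ideal.mem_sup_left (hC 0)
      | insert s T hs ihT =>
        rw [Finset.sum_insert hs]
        refine hadd' _ _ ?_ ihT
        have h1 : t s * E (g s) ∈ q ⊔ maximalIdeal S ^ (r + 1) := by
          have := Ideal.mul_mem_mul (ht s) (ih (g s))
          rw [Ideal.mul_sup, ← pow_succ'] at this
          have hle : maximalIdeal S * q ⊔ maximalIdeal S ^ (r + 1) ≤
              q ⊔ maximalIdeal S ^ (r + 1) := sup_le_sup Ideal.mul_le_right le_rfl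
          exact hle this
        have := add_mem (Ideal.mem_sup_left (hX s (g s))) h1
        simpa using this
    rw [sub_eq_iff_eq_add] at hg
    rw [hg]
    exact hadd' _ _ (hsum _) (Ideal.mem_sup_left (hC _))

theorem derivation_apply_mem_pow {S : Type*} [CommRing S] [Algebra ℂ S] (m : Ideal S)
    (D : Derivation ℂ S S) (r : ℕ) {f : S} (hf : f ∈ m ^ (r + 1)) : D f ∈ m ^ r := by
  induction r generalizing f with
  | zero => simp
  | succ r ih =>
    rw [pow_succ] at hf
    refine Submodule.mul_induction_on hf ?_ ?_
    · intro a ha b hb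
      rw [D.leibniz, smul_eq_mul, smul_eq_mul]
      refine add_mem (Ideal.mul_mem_right _ _ ha) ?_
      rw [pow_succ']
      exact Ideal.mul_mem_mul hb (ih ha)
    · intro a b ha hb
      rw [map_add]
      exact add_mem ha hb

theorem sub_linear_mem_sq (f : MvPowerSeries σ ℂ) :
    f - C (constantCoeff f) - ∑ s, C (constantCoeff (pderiv ℂ s f)) * X s ∈
      maximalIdeal (MvPowerSeries σ ℂ) ^ 2 := by
  classical
  obtain ⟨g, hg⟩ := exists_eq_sum_X_mul (f := f - C (constantCoeff f)) (by simp)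
  have hd : ∀ s, constantCoeff (pderiv ℂ s f) = constantCoeff (g s) := by
    intro s
    have : f = C (constantCoeff f) + ∑ s, X s * g s := by rw [← hg]; ring
    rw [this]
    simp only [map_add, pderiv_C, map_sum, Derivation.leibniz, smul_eq_mul, map_mul, zero_add,
      constantCoeff_X, zero_mul]
    rw [Finset.sum_eq_single s]
    · simp [pderiv_X_self]
    · intro t _ hts
      simp [pderiv_X_of_ne hts]
    · simp
  simp only [hd]
  rw [hg, ← Finset.sum_sub_distrib]
  refine sum_mem fun s _ => ?_
  rw [show X s * g s - C (constantCoeff (g s)) * X s = X s * (g s - C (constantCoeff (g s))) by ring,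
    pow_two]
  exact Ideal.mul_mem_mul (mem_maximalIdeal_iff.2 (by simp)) (mem_maximalIdeal_iff.2 (by simp))

theorem derivation_C {σ : Type} (D : Derivation ℂ (MvPowerSeries σ ℂ) (MvPowerSeries σ ℂ))
    (c : ℂ) : D (C c) = 0 :=
  D.map_algebraMap c

theorem algHom_C {σ τ : Type} (h : MvPowerSeries σ ℂ →ₐ[ℂ] MvPowerSeries τ ℂ) (c : ℂ) :
    h (C c) = C c :=
  h.commutes c

section LocalHom

variable {τ : Type} {h : MvPowerSeries σ ℂ →ₐ[ℂ] MvPowerSeries τ ℂ}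

theorem constantCoeff_algHom (hX : ∀ s, constantCoeff (h (X s)) = 0)
    (f : MvPowerSeries σ ℂ) :
    constantCoeff (h f) = constantCoeff f := by
  obtain ⟨g, hg⟩ := exists_eq_sum_X_mul (f := f - C (constantCoeff f)) (by simp)
  rw [sub_eq_iff_eq_add] at hg
  have := congrArg (fun f => constantCoeff (h f)) hg
  simpa [hX, algHom_C] using this

theorem algHom_mem_pow (hX : ∀ s, constantCoeff (h (X s)) = 0)
    {r : ℕ} {f : MvPowerSeries σ ℂ}
    (hf : f ∈ maximalIdeal (MvPowerSeries σ ℂ) ^ r) :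
    h f ∈ maximalIdeal (MvPowerSeries τ ℂ) ^ r := by
  have hle : (maximalIdeal (MvPowerSeries σ ℂ)).map h ≤ maximalIdeal _ := by
    rw [Ideal.map_le_iff_le_comap]
    intro g hg
    rw [Ideal.mem_comap, mem_maximalIdeal_iff, constantCoeff_algHom hX]
    exact mem_maximalIdeal_iff.1 hg
  exact Ideal.pow_right_mono hle r (by rw [← Ideal.map_pow]; exact Ideal.mem_map_of_mem _ hf)

/-- A derivation lowers powers of the maximal ideal by at most one, so only the linear part of `f`
contributes at `0`. -/
theorem constantCoeff_derivation_algHom (hX : ∀ s, constantCoeff (h (X s)) = 0)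
    (D : Derivation ℂ (MvPowerSeries τ ℂ) (MvPowerSeries τ ℂ)) (f : MvPowerSeries σ ℂ) :
    constantCoeff (D (h f)) =
      ∑ s, constantCoeff (D (h (X s))) * constantCoeff (pderiv ℂ s f) := by
  have h3 := derivation_apply_mem_pow _ D 1 (algHom_mem_pow hX (sub_linear_mem_sq f))
  rw [pow_one, mem_maximalIdeal_iff] at h3
  simp only [map_sub, map_sum, map_mul, Derivation.leibniz, algHom_C, derivation_C, smul_eq_mul,
    mul_zero, add_zero, constantCoeff_C, sub_zero] at h3
  rw [sub_eq_zero] at h3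
  rw [h3]
  exact Finset.sum_congr rfl fun s _ => mul_comm _ _

end LocalHom

theorem constantCoeff_derivation
    (D : Derivation ℂ (MvPowerSeries σ ℂ) (MvPowerSeries σ ℂ)) (f : MvPowerSeries σ ℂ) :
    constantCoeff (D f) = ∑ s, constantCoeff (D (X s)) * constantCoeff (pderiv ℂ s f) :=
  constantCoeff_derivation_algHom (h := AlgHom.id ℂ _) (by simp) D f

end PowerSeries

/-! ### Ideal membership detected by iterated derivatives at the origin. -/

section PowerSeries

variable {σ : Type} [Fintype σ]

/-- The derivative in the direction of a constant vector. -/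
def dirDeriv (v : σ → ℂ) : Derivation ℂ (MvPowerSeries σ ℂ) (MvPowerSeries σ ℂ) :=
  ∑ s, v s • pderiv ℂ s

theorem dirDeriv_apply (v : σ → ℂ) (f : MvPowerSeries σ ℂ) :
    dirDeriv v f = ∑ s, v s • pderiv ℂ s f := by
  rw [dirDeriv, ← Derivation.coeFnAddMonoidHom_apply, map_sum, Finset.sum_apply]
  rfl

theorem constantCoeff_dirDeriv (v : σ → ℂ) (f : MvPowerSeries σ ℂ) :
    constantCoeff (dirDeriv v f) = ∑ s, v s * constantCoeff (pderiv ℂ s f) := by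
  rw [dirDeriv_apply, map_sum]
  simp

theorem dirDeriv_X (v : σ → ℂ) (s : σ) : dirDeriv v (X s) = C (v s) := by
  rw [dirDeriv_apply, Finset.sum_eq_single s]
  · rw [pderiv_X_self, smul_eq_C_mul, mul_one]
  · intro t _ hts
    rw [pderiv_X_of_ne hts.symm, smul_zero]
  · simp

/-- Both `D ∘ h` and `h ∘ dirDeriv v` are derivations along `h`, and they agree modulo the maximal
ideal; the Leibniz rule propagates this. Hence only the value of `D` at `0` affects leading terms.
-/
theorem derivation_algHom_sub_mem_pow {τ : Type} {h : MvPowerSeries σ ℂ →ₐ[ℂ] MvPowerSeries τ ℂ}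
    (hX : ∀ s, constantCoeff (h (X s)) = 0)
    (D : Derivation ℂ (MvPowerSeries τ ℂ) (MvPowerSeries τ ℂ)) {v : σ → ℂ}
    (hv : ∀ s, constantCoeff (D (h (X s))) = v s) {r : ℕ} {g : MvPowerSeries σ ℂ}
    (hg : g ∈ maximalIdeal (MvPowerSeries σ ℂ) ^ r) :
    D (h g) - h (dirDeriv v g) ∈ maximalIdeal (MvPowerSeries τ ℂ) ^ r := by
  have h1 : ∀ g, D (h g) - h (dirDeriv v g) ∈ maximalIdeal (MvPowerSeries τ ℂ) := by
    intro g
    rw [mem_maximalIdeal_iff, map_sub, constantCoeff_derivation_algHom hX,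
      constantCoeff_algHom hX, constantCoeff_dirDeriv, sub_eq_zero]
    simp only [hv]
  induction r generalizing g with
  | zero => simp
  | succ r ih =>
    rw [pow_succ] at hg
    refine Submodule.mul_induction_on hg ?_ ?_
    · intro a ha b hb
      have : D (h (a * b)) - h (dirDeriv v (a * b)) =
          h a * (D (h b) - h (dirDeriv v b)) + (D (h a) - h (dirDeriv v a)) * h b := by
        simp only [map_mul, Derivation.leibniz, smul_eq_mul, map_add]
        ring
      rw [this, pow_succ]
      refine add_mem (Ideal.mul_mem_mul (algHom_mem_pow hX ha) (h1 b))
        (Ideal.mul_mem_mul (ih ha) ?_)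
      have := algHom_mem_pow (r := 1) hX (by rwa [pow_one])
      rwa [pow_one] at this
    · intro a b ha hb
      have : D (h (a + b)) - h (dirDeriv v (a + b)) =
          (D (h a) - h (dirDeriv v a)) + (D (h b) - h (dirDeriv v b)) := by
        simp only [map_add]
        ring
      rw [this]
      exact add_mem ha hb

/-- The successive application of operators, the head of the list acting first. -/
def applyWord {ι A : Type*} (D : ι → A → A) (l : List ι) (f : A) : A :=
  l.foldl (fun g i => D i g) f

@[simp] theorem applyWord_nil {ι A : Type*} (D : ι → A → A) (f : A) : applyWord D [] f = f := rfl

@[simp] theorem applyWord_cons {ι A : Type*} (D : ι → A → A) (i : ι) (l : List ι) (f : A) :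
    applyWord D (i :: l) f = applyWord D l (D i f) := rfl

theorem applyWord_add {ι A : Type*} [CommRing A] [Algebra ℂ A] (D : ι → Derivation ℂ A A)
    (l : List ι) (f g : A) : applyWord (fun i f => D i f) l (f + g) =
      applyWord (fun i f => D i f) l f + applyWord (fun i f => D i f) l g := by
  induction l generalizing f g with
  | nil => rfl
  | cons i l ih => simp [ih]

theorem applyWord_mem {ι A : Type*} [CommRing A] [Algebra ℂ A] (D : ι → Derivation ℂ A A)
    {q : Ideal A} (l : List ι) (hq : ∀ i ∈ l, ∀ f ∈ q, D i f ∈ q)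
    {f : A} (hf : f ∈ q) : applyWord (fun i f => D i f) l f ∈ q := by
  induction l generalizing f with
  | nil => exact hf
  | cons i l ih =>
    exact ih (fun j hj => hq j (List.mem_cons_of_mem _ hj)) (hq i List.mem_cons_self f hf)

theorem applyWord_mem_pow {ι A : Type*} [CommRing A] [Algebra ℂ A] (D : ι → Derivation ℂ A A)
    (m : Ideal A) (l : List ι) (r : ℕ) {f : A} (hf : f ∈ m ^ (l.length + r)) :
    applyWord (fun i f => D i f) l f ∈ m ^ r := by
  induction l generalizing f with
  | nil => simpa using hf
  | cons i l ih =>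
    refine ih (derivation_apply_mem_pow m (D i) _ ?_)
    convert hf using 2
    simp
    omega

/-- Replacing one derivation by its constant-coefficient model makes an error of order one more than
the number of remaining letters, which is invisible at `0`. -/
theorem constantCoeff_applyWord_algHom {τ ι : Type}
    {h : MvPowerSeries σ ℂ →ₐ[ℂ] MvPowerSeries τ ℂ} (hX : ∀ s, constantCoeff (h (X s)) = 0)
    (D : ι → Derivation ℂ (MvPowerSeries τ ℂ) (MvPowerSeries τ ℂ)) {v : ι → σ → ℂ}
    (hv : ∀ i s, constantCoeff (D i (h (X s))) = v i s) (l : List ι) {g : MvPowerSeries σ ℂ}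
    (hg : g ∈ maximalIdeal (MvPowerSeries σ ℂ) ^ l.length) :
    constantCoeff (applyWord (fun i f => D i f) l (h g)) =
      constantCoeff (applyWord (fun i f => dirDeriv (v i) f) l g) := by
  induction l generalizing g with
  | nil => exact constantCoeff_algHom hX g
  | cons i l ih =>
    rw [applyWord_cons, applyWord_cons, ← ih (derivation_apply_mem_pow _ _ _ hg)]
    have h1 := derivation_algHom_sub_mem_pow hX (D i) (hv i) hg
    have h2 := applyWord_mem_pow D _ l 1 h1
    rw [pow_one, mem_maximalIdeal_iff] at h2
    rw [show D i (h g) = h (dirDeriv (v i) g) + (D i (h g) - h (dirDeriv (v i) g)) by ring,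
      applyWord_add, map_add, h2, add_zero]

/-- The vectors annihilated by the differentials at `0` of the series `w j`. -/
def tangentSpace {κ : Type} (w : κ → MvPowerSeries σ ℂ) : Submodule ℂ (σ → ℂ) where
  carrier := {v | ∀ j, ∑ s, v s * constantCoeff (pderiv ℂ s (w j)) = 0}
  add_mem' := by
    intro a b ha hb j
    simp only [Pi.add_apply, add_mul, Finset.sum_add_distrib, ha j, hb j, add_zero]
  zero_mem' := by
    intro j
    simp
  smul_mem' := by
    intro c a ha j
    simp only [Pi.smul_apply, smul_eq_mul, mul_assoc, ← Finset.mul_sum, ha j, mul_zero]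

theorem mem_tangentSpace {κ : Type} {w : κ → MvPowerSeries σ ℂ} {v : σ → ℂ} :
    v ∈ tangentSpace w ↔ ∀ j, ∑ s, v s * constantCoeff (pderiv ℂ s (w j)) = 0 := Iff.rfl

/-- The differential at `0`. -/
def differential (f : MvPowerSeries σ ℂ) : (σ → ℂ) →ₗ[ℂ] ℂ :=
  ∑ s, constantCoeff (pderiv ℂ s f) • LinearMap.proj s

theorem differential_apply (f : MvPowerSeries σ ℂ) (v : σ → ℂ) :
    differential f v = ∑ s, v s * constantCoeff (pderiv ℂ s f) := by
  simp [differential, mul_comm]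

/-- The linear form as a power series. -/
def linearSeries (σ : Type) [Fintype σ] : ((σ → ℂ) →ₗ[ℂ] ℂ) →ₗ[ℂ] MvPowerSeries σ ℂ where
  toFun ξ := by
    classical
    exact ∑ s, C (ξ (Pi.single s 1)) * X s
  map_add' ξ η := by simp [add_mul, Finset.sum_add_distrib]
  map_smul' c ξ := by
    simp [Finset.smul_sum, smul_eq_C_mul, mul_assoc]

theorem sub_linearSeries_differential_mem {f : MvPowerSeries σ ℂ} (hf : constantCoeff f = 0) :
    f - linearSeries σ (differential f) ∈ maximalIdeal (MvPowerSeries σ ℂ) ^ 2 := by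
  classical
  have h := sub_linear_mem_sq f
  rw [hf, map_zero, sub_zero] at h
  convert h using 3
  rw [linearSeries, LinearMap.coe_mk, AddHom.coe_mk]
  refine Finset.sum_congr rfl fun s _ => ?_
  congr 2
  rw [differential_apply, Finset.sum_eq_single s]
  · simp
  · intro t _ hts
    simp [hts]
  · simp

theorem constantCoeff_linearSeries (ξ : (σ → ℂ) →ₗ[ℂ] ℂ) :
    constantCoeff (linearSeries σ ξ) = 0 := by
  simp [linearSeries]

/-- A derivation that acts as the identity on the cotangent space modulo `q` acts as the
multiplication by `r` on forms of degree `r`. -/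
theorem euler_sub_mem {A : Type*} [CommRing A] [Algebra ℂ A] {m q : Ideal A}
    (θ : Derivation ℂ A A) (h0 : ∀ y, θ y ∈ m) (h1 : ∀ y ∈ m, θ y - y ∈ q ⊔ m ^ 2)
    (r : ℕ) {g : A} (hg : g ∈ m ^ r) : θ g - r * g ∈ q ⊔ m ^ (r + 1) := by
  induction r generalizing g with
  | zero =>
    simpa using Ideal.mem_sup_right (h0 g)
  | succ r ih =>
    rw [pow_succ] at hg
    refine Submodule.mul_induction_on hg ?_ ?_
    · intro a ha b hb
      have : θ (a * b) - ((r + 1 : ℕ) : A) * (a * b) = a * (θ b - b) + b * (θ a - r * a) := by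
        rw [Derivation.leibniz, smul_eq_mul, smul_eq_mul]
        push_cast
        ring
      rw [this]
      refine add_mem ?_ ?_
      · have h2 := Ideal.mul_mem_mul ha (h1 b hb)
        rw [Ideal.mul_sup, ← pow_add] at h2
        exact (sup_le_sup Ideal.mul_le_right le_rfl :
          m ^ r * q ⊔ m ^ (r + 2) ≤ q ⊔ m ^ (r + 2)) h2
      · have h2 := Ideal.mul_mem_mul hb (ih ha)
        rw [Ideal.mul_sup, ← pow_succ'] at h2
        exact (sup_le_sup Ideal.mul_le_right le_rfl :
          m * q ⊔ m ^ (r + 1 + 1) ≤ q ⊔ m ^ (r + 1 + 1)) h2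
    · intro a b ha hb
      have : θ (a + b) - ((r + 1 : ℕ) : A) * (a + b) =
          (θ a - ((r + 1 : ℕ) : A) * a) + (θ b - ((r + 1 : ℕ) : A) * b) := by
        rw [map_add]
        ring
      rw [this]
      exact add_mem ha hb

/-- The `x k` are linear forms extending a dual basis of the tangent space. The field `∑ x_k
∂_{u_k}` then fixes linear forms up to forms vanishing on the tangent space, and these come from the
differentials of the `w j`. -/
theorem exists_euler {κ : Type} [Finite κ] {w : κ → MvPowerSeries σ ℂ}
    (hw : ∀ j, constantCoeff (w j) = 0) :
    ∃ (n : ℕ) (u : Fin n → σ → ℂ) (x : Fin n → MvPowerSeries σ ℂ),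
      (∀ k, u k ∈ tangentSpace w) ∧ (∀ k, constantCoeff (x k) = 0) ∧
      ∀ y, constantCoeff y = 0 → ∑ k, x k * dirDeriv (u k) y - y ∈
        Ideal.span (Set.range w) ⊔ maximalIdeal (MvPowerSeries σ ℂ) ^ 2 := by
  classical
  let b := Module.finBasis ℂ (tangentSpace w)
  choose ξ hξ using fun k => LinearMap.exists_extend (b.coord k)
  refine ⟨_, fun k => b k, fun k => linearSeries σ (ξ k), fun k => (b k).2,
    fun k => constantCoeff_linearSeries _, ?_⟩
  intro y hy
  set q := Ideal.span (Set.range w) with hq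
  set m := maximalIdeal (MvPowerSeries σ ℂ) with hm
  let μ : (σ → ℂ) →ₗ[ℂ] ℂ := ∑ k, differential y (b k) • ξ k - differential y
  -- The tangent space is the common kernel of the differentials of the `w j`, so a form vanishing
  -- there is a combination of them.
  have hμ : μ ∈ Submodule.span ℂ (Set.range fun j => differential (w j)) := by
    apply FiniteDimensional.mem_span_of_iInf_ker_le_ker
    intro v hv
    have hv' : v ∈ tangentSpace w := by
      intro j
      have := (Submodule.mem_iInf _).1 hv j
      rwa [LinearMap.mem_ker, differential_apply] at this
    rw [LinearMap.mem_ker]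
    have h1 : ∀ k, ξ k v = b.repr ⟨v, hv'⟩ k := by
      intro k
      have := LinearMap.congr_fun (hξ k) ⟨v, hv'⟩
      simpa using this
    have h2 : v = ∑ k, b.repr ⟨v, hv'⟩ k • (b k : σ → ℂ) := by
      have := congrArg (tangentSpace w).subtype (b.sum_repr ⟨v, hv'⟩)
      rw [map_sum] at this
      exact this.symm
    have h3 : differential y v = ∑ k, b.repr ⟨v, hv'⟩ k * differential y (b k) := by
      conv_lhs => rw [h2]
      simp
    simp only [μ, LinearMap.sub_apply, LinearMap.sum_apply, LinearMap.smul_apply, smul_eq_mul, h1,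
      h3]
    rw [sub_eq_zero]
    exact Finset.sum_congr rfl fun k _ => mul_comm _ _
  have hlin : linearSeries σ μ ∈ q ⊔ m ^ 2 := by
    refine Submodule.span_induction (p := fun μ _ => linearSeries σ μ ∈ q ⊔ m ^ 2)
      ?_ ?_ ?_ ?_ hμ
    · rintro _ ⟨j, rfl⟩
      have h0 : w j ∈ q := Ideal.subset_span ⟨j, rfl⟩
      have h1 := sub_mem (Ideal.mem_sup_left h0)
        (Ideal.mem_sup_right (S := q) (sub_linearSeries_differential_mem (hw j)))
      rwa [sub_sub_cancel] at h1
    · simp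
    · intro a b _ _ ha hb
      rw [map_add]
      exact add_mem ha hb
    · intro c a _ ha
      rw [map_smul, smul_eq_C_mul]
      exact Ideal.mul_mem_left _ _ ha
  have h1 : ∀ k, linearSeries σ (ξ k) * dirDeriv (b k : σ → ℂ) y -
      differential y (b k) • linearSeries σ (ξ k) ∈ m ^ 2 := by
    intro k
    rw [smul_eq_C_mul, mul_comm (C _), ← mul_sub, pow_two]
    refine Ideal.mul_mem_mul (mem_maximalIdeal_iff.2 (constantCoeff_linearSeries _))
      (mem_maximalIdeal_iff.2 ?_)
    rw [map_sub, constantCoeff_C, constantCoeff_dirDeriv, differential_apply, sub_self]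
  have h2 := sub_linearSeries_differential_mem hy
  have h3 := add_mem hlin (Ideal.mem_sup_right (S := q)
    (sub_mem (sum_mem fun k (_ : k ∈ Finset.univ) => h1 k) h2))
  convert h3 using 1
  simp only [μ, map_sub, map_sum, map_smul, Finset.sum_sub_distrib]
  ring

/-- Euler's identity recovers a form of degree `r` from its first derivatives along the tangent
space, modulo the ideal of `w`; induction applies to those derivatives. -/
theorem mem_sup_of_applyWord_dirDeriv {κ : Type} [Finite κ] {w : κ → MvPowerSeries σ ℂ}
    (hw : ∀ j, constantCoeff (w j) = 0) (r : ℕ) {g : MvPowerSeries σ ℂ}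
    (hg : g ∈ maximalIdeal (MvPowerSeries σ ℂ) ^ r)
    (h : ∀ l : List (tangentSpace w), l.length = r →
      constantCoeff (applyWord (fun (v : tangentSpace w) f => dirDeriv (v : σ → ℂ) f) l g) = 0) :
    g ∈ Ideal.span (Set.range w) ⊔ maximalIdeal (MvPowerSeries σ ℂ) ^ (r + 1) := by
  obtain ⟨n, u, x, hu, hx, hux⟩ := exists_euler hw
  let θ : Derivation ℂ (MvPowerSeries σ ℂ) (MvPowerSeries σ ℂ) := ∑ k, x k • dirDeriv (u k)
  have hθ : ∀ y, θ y = ∑ k, x k * dirDeriv (u k) y := by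
    intro y
    simp only [θ]
    rw [← Derivation.coeFnAddMonoidHom_apply, map_sum, Finset.sum_apply]
    rfl
  induction r generalizing g with
  | zero =>
    rw [zero_add, pow_one]
    exact Ideal.mem_sup_right (mem_maximalIdeal_iff.2 (h [] rfl))
  | succ r ih =>
    have h1 := euler_sub_mem (q := Ideal.span (Set.range w)) θ
      (fun y => by
        rw [hθ]
        exact sum_mem fun k _ => Ideal.mul_mem_right _ _ (mem_maximalIdeal_iff.2 (hx k)))
      (fun y hy => by
        rw [hθ]
        exact hux y (mem_maximalIdeal_iff.1 hy)) (r + 1) hg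
    have h2 : θ g ∈ Ideal.span (Set.range w) ⊔
        maximalIdeal (MvPowerSeries σ ℂ) ^ (r + 1 + 1) := by
      rw [hθ]
      refine sum_mem fun k _ => ?_
      have h3 := ih (derivation_apply_mem_pow _ (dirDeriv (u k)) _ hg) (fun l hl => by
        exact h (⟨u k, hu k⟩ :: l) (by simp [hl]))
      have h4 := Ideal.mul_mem_mul (mem_maximalIdeal_iff.2 (hx k)) h3
      rw [Ideal.mul_sup, ← pow_succ'] at h4
      exact (sup_le_sup Ideal.mul_le_right le_rfl : _ ≤ Ideal.span (Set.range w) ⊔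
        maximalIdeal (MvPowerSeries σ ℂ) ^ (r + 1 + 1)) h4
    have h5 := sub_mem h2 h1
    rw [sub_sub_cancel] at h5
    -- Division by the degree uses characteristic zero.
    have h6 := Ideal.mul_mem_left _ (C (((r + 1 : ℕ) : ℂ)⁻¹)) h5
    rw [← mul_assoc, ← map_natCast (C (σ := σ) (R := ℂ)), ← map_mul,
      inv_mul_cancel₀ (by exact_mod_cast Nat.succ_ne_zero r), map_one, one_mul] at h6
    exact h6

/-- The criterion in terms of derivations whose values at `0` are prescribed. -/
theorem mem_sup_of_applyWord {κ τ : Type} [Finite κ] {w : κ → MvPowerSeries σ ℂ}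
    (hw : ∀ j, constantCoeff (w j) = 0)
    {h : MvPowerSeries σ ℂ →ₐ[ℂ] MvPowerSeries τ ℂ} (hX : ∀ s, constantCoeff (h (X s)) = 0)
    (D : tangentSpace w → Derivation ℂ (MvPowerSeries τ ℂ) (MvPowerSeries τ ℂ))
    (hD : ∀ v s, constantCoeff (D v (h (X s))) = (v : σ → ℂ) s) (q : Ideal (MvPowerSeries τ ℂ))
    (hq : q ≤ maximalIdeal _) (hDq : ∀ v, ∀ f ∈ q, D v f ∈ q) (hwq : ∀ j, h (w j) ∈ q)
    (n : ℕ) {f : MvPowerSeries σ ℂ}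
    (hf : ∀ l : List (tangentSpace w), l.length < n →
      constantCoeff (applyWord (fun v f => D v f) l (h f)) = 0) :
    f ∈ Ideal.span (Set.range w) ⊔ maximalIdeal (MvPowerSeries σ ℂ) ^ n := by
  induction n with
  | zero => simp
  | succ r ih =>
    -- The words annihilate `h a` at `0` because they preserve `q`; the remainder `g` has order `r`,
    -- and words of length `r` see only its leading form.
    obtain ⟨a, ha, g, hg, rfl⟩ := Submodule.mem_sup.1 (ih fun l hl => hf l (by omega))
    refine add_mem (Ideal.mem_sup_left ha) (mem_sup_of_applyWord_dirDeriv hw r hg ?_)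
    intro l hl
    rw [← constantCoeff_applyWord_algHom hX D hD l (by rwa [hl])]
    have h1 := hf l (by omega)
    have h2 : h a ∈ q := by
      have : Ideal.span (Set.range w) ≤ q.comap h := by
        rw [Ideal.span_le]
        rintro _ ⟨j, rfl⟩
        exact hwq j
      exact this ha
    have h3 := mem_maximalIdeal_iff.1 (hq (applyWord_mem D l (fun v _ => hDq v) h2))
    rw [map_add, applyWord_add, map_add, h3, zero_add] at h1
    exact h1

end PowerSeries

/-! ### Algebra homomorphisms: congruences, Taylor formula, chain rule, formal inverse function
theorem. -/

section PowerSeries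

variable {σ τ : Type} [Fintype σ] [Fintype τ]

/-- No continuity of `h` or `k` is assumed; closedness of `q` replaces it. -/
theorem algHom_sub_mem {h k : MvPowerSeries σ ℂ →ₐ[ℂ] MvPowerSeries τ ℂ}
    (hX : ∀ s, constantCoeff (k (X s)) = 0) {q : Ideal (MvPowerSeries τ ℂ)}
    (hq : ∀ s, h (X s) - k (X s) ∈ q) (f : MvPowerSeries σ ℂ) : h f - k f ∈ q := by
  refine mem_of_map_X_mul (q := q) (fun f => h f - k f) (fun s => k (X s))
    (fun s => mem_maximalIdeal_iff.2 (hX s)) ?_ ?_ ?_ f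
  · intro f g
    convert q.zero_mem using 1
    simp only [map_add]
    ring
  · intro c
    simp [algHom_C]
  · intro s g
    convert q.mul_mem_right (h g) (hq s) using 1
    simp only [map_mul]
    ring

theorem taylor_mem {h k : MvPowerSeries σ ℂ →ₐ[ℂ] MvPowerSeries τ ℂ}
    (hX : ∀ s, constantCoeff (k (X s)) = 0) {q : Ideal (MvPowerSeries τ ℂ)}
    (hq : ∀ s, h (X s) - k (X s) ∈ q) (f : MvPowerSeries σ ℂ) :
    h f - k f - ∑ s, k (pderiv ℂ s f) * (h (X s) - k (X s)) ∈ q ^ 2 := by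
  refine mem_of_map_X_mul (q := q ^ 2)
    (fun f => h f - k f - ∑ s, k (pderiv ℂ s f) * (h (X s) - k (X s))) (fun s => k (X s))
    (fun s => mem_maximalIdeal_iff.2 (hX s)) ?_ ?_ ?_ f
  · intro f g
    convert (q ^ 2).zero_mem using 1
    simp only [map_add, add_mul, Finset.sum_add_distrib]
    ring
  · intro c
    simp [algHom_C]
  · intro s g
    rw [pow_two]
    -- The defect of linearity over `X s` is exactly the product of two first-order differences.
    convert Ideal.mul_mem_mul (hq s) (algHom_sub_mem hX hq g) using 1
    have h1 : ∑ t, k (pderiv ℂ t (X s * g)) * (h (X t) - k (X t)) =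
        k g * (h (X s) - k (X s)) +
          k (X s) * ∑ t, k (pderiv ℂ t g) * (h (X t) - k (X t)) := by
      simp only [Derivation.leibniz, smul_eq_mul, map_add, map_mul, add_mul,
        Finset.sum_add_distrib, Finset.mul_sum]
      rw [add_comm]
      congr 1
      · rw [Finset.sum_eq_single s]
        · rw [pderiv_X_self, map_one, mul_one]
        · intro t _ hts
          rw [pderiv_X_of_ne hts.symm, map_zero, mul_zero, zero_mul]
        · simp
      · exact Finset.sum_congr rfl fun t _ => by ring
    rw [h1]
    simp only [map_mul]
    ring

/-- The chain rule; `h` need not be linear. -/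
theorem derivation_ringHom (h : MvPowerSeries σ ℂ →+* MvPowerSeries τ ℂ)
    (hC : ∀ c, ∃ c', h (C c) = C c') (hX : ∀ s, constantCoeff (h (X s)) = 0)
    (D : Derivation ℂ (MvPowerSeries τ ℂ) (MvPowerSeries τ ℂ)) (f : MvPowerSeries σ ℂ) :
    D (h f) = ∑ s, D (h (X s)) * h (pderiv ℂ s f) := by
  rw [← sub_eq_zero, ← Ideal.mem_bot]
  refine mem_of_map_X_mul (q := ⊥)
    (fun f => D (h f) - ∑ s, D (h (X s)) * h (pderiv ℂ s f)) (fun s => h (X s))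
    (fun s => mem_maximalIdeal_iff.2 (hX s)) ?_ ?_ ?_ f
  · intro f g
    rw [Ideal.mem_bot]
    simp only [map_add, mul_add, Finset.sum_add_distrib]
    ring
  · intro c
    obtain ⟨c', hc'⟩ := hC c
    simp [hc', derivation_C]
  · intro s g
    rw [Ideal.mem_bot]
    have h1 : ∑ t, D (h (X t)) * h (pderiv ℂ t (X s * g)) =
        D (h (X s)) * h g + h (X s) * ∑ t, D (h (X t)) * h (pderiv ℂ t g) := by
      simp only [Derivation.leibniz, smul_eq_mul, map_add, map_mul, mul_add,
        Finset.sum_add_distrib, Finset.mul_sum]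
      rw [add_comm]
      congr 1
      · rw [Finset.sum_eq_single s]
        · rw [pderiv_X_self, map_one, mul_one]
        · intro t _ hts
          rw [pderiv_X_of_ne hts.symm, map_zero, mul_zero, mul_zero]
        · simp
      · exact Finset.sum_congr rfl fun t _ => by ring
    rw [h1]
    simp only [map_mul, Derivation.leibniz, smul_eq_mul]
    ring

/-- By Nakayama's lemma the images of the variables generate the maximal ideal, and completeness
lifts surjectivity from the residue field. -/
theorem algHom_surjective (φ : MvPowerSeries σ ℂ →ₐ[ℂ] MvPowerSeries τ ℂ)
    (hX : ∀ s, constantCoeff (φ (X s)) = 0)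
    (hspan : maximalIdeal (MvPowerSeries τ ℂ) ≤
      Ideal.span (Set.range fun s => φ (X s)) ⊔ maximalIdeal (MvPowerSeries τ ℂ) ^ 2) :
    Function.Surjective φ := by
  have hmap : (Ideal.span (Set.range (X : σ → MvPowerSeries σ ℂ))).map
      (φ : MvPowerSeries σ ℂ →+* MvPowerSeries τ ℂ) =
      maximalIdeal (MvPowerSeries τ ℂ) := by
    rw [Ideal.map_span, ← Set.range_comp]
    apply le_antisymm
    · rw [Ideal.span_le]
      rintro _ ⟨s, rfl⟩
      exact mem_maximalIdeal_iff.2 (hX s)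
    · refine Submodule.le_of_le_smul_of_le_jacobson_bot (I := maximalIdeal _)
        (IsNoetherian.noetherian _) (IsLocalRing.maximalIdeal_le_jacobson _) ?_
      rw [smul_eq_mul, ← pow_two]
      exact hspan
  have hH : IsHausdorff ((Ideal.span (Set.range (X : σ → MvPowerSeries σ ℂ))).map
      (φ : MvPowerSeries σ ℂ →+* MvPowerSeries τ ℂ)) (MvPowerSeries τ ℂ) := by
    rw [hmap, maximalIdeal_eq_span]
    infer_instance
  refine surjective_of_mk_map_comp_surjective (φ : MvPowerSeries σ ℂ →+* MvPowerSeries τ ℂ)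
    (I := Ideal.span (Set.range X)) ?_
  intro z
  obtain ⟨f, rfl⟩ := Ideal.Quotient.mk_surjective z
  refine ⟨C (constantCoeff f), ?_⟩
  rw [RingHom.comp_apply, Ideal.Quotient.eq, hmap, mem_maximalIdeal_iff]
  simp [algHom_C]

theorem ringHom_injective_of_surjective {A : Type*} [CommRing A] [IsNoetherianRing A] (φ : A →+* A)
    (hφ : Function.Surjective φ) : Function.Injective φ := by
  rw [injective_iff_map_eq_zero]
  intro x hx
  let F : ℕ →o Ideal A :=
    ⟨fun n => RingHom.ker (φ ^ n), monotone_nat_of_le_succ fun n x hx => by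
      rw [RingHom.mem_ker] at hx ⊢
      rw [pow_succ', RingHom.mul_def, RingHom.comp_apply, hx, map_zero]⟩
  obtain ⟨n, hn⟩ := monotone_stabilizes_iff_noetherian.2 (inferInstance : IsNoetherian A A) F
  have hsurj : Function.Surjective (φ ^ n) := by
    rw [RingHom.coe_pow]
    exact hφ.iterate n
  obtain ⟨y, rfl⟩ := hsurj x
  have h1 : y ∈ F (n + 1) := by
    change (φ ^ (n + 1)) y = 0
    rw [pow_succ', RingHom.mul_def, RingHom.comp_apply, hx]
  rw [← hn (n + 1) (by omega)] at h1
  exact h1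

/-- With equally many variables, composing with a renaming gives a surjective endomorphism of a
Noetherian ring, which is injective. -/
theorem algHom_bijective (e : σ ≃ τ) (φ : MvPowerSeries σ ℂ →ₐ[ℂ] MvPowerSeries τ ℂ)
    (hX : ∀ s, constantCoeff (φ (X s)) = 0)
    (hspan : maximalIdeal (MvPowerSeries τ ℂ) ≤
      Ideal.span (Set.range fun s => φ (X s)) ⊔ maximalIdeal (MvPowerSeries τ ℂ) ^ 2) :
    Function.Bijective φ := by
  have hs := algHom_surjective φ hX hspan
  refine ⟨?_, hs⟩
  have h1 := ringHom_injective_of_surjective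
    ((renameEquiv ℂ e.symm : MvPowerSeries τ ℂ →+* MvPowerSeries σ ℂ).comp
      (φ : MvPowerSeries σ ℂ →+* MvPowerSeries τ ℂ))
    ((renameEquiv ℂ e.symm).surjective.comp hs)
  intro a b hab
  apply h1
  simp only [RingHom.comp_apply]
  exact congrArg _ hab

end PowerSeries

/-! ### Primes stay prime after adjoining variables. -/

section Iterated

variable {σ τ : Type}

/-- The power series with given coefficients. -/
def ofCoeff {R : Type*} (c : (σ →₀ ℕ) → R) : MvPowerSeries σ R := c

@[simp] theorem coeff_ofCoeff {R : Type*} [Semiring R] (c : (σ →₀ ℕ) → R) (e : σ →₀ ℕ) :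
    coeff e (ofCoeff c) = c e := rfl

theorem sumElim_comapDomain (e : σ ⊕ τ →₀ ℕ) :
    Finsupp.sumElim (e.comapDomain Sum.inl Sum.inl_injective.injOn)
      (e.comapDomain Sum.inr Sum.inr_injective.injOn) = e := by
  ext (i | i) <;> simp

theorem comapDomain_inl_sumElim (α : σ →₀ ℕ) (β : τ →₀ ℕ) :
    (Finsupp.sumElim α β).comapDomain Sum.inl Sum.inl_injective.injOn = α := by
  ext i
  simp

theorem comapDomain_inr_sumElim (α : σ →₀ ℕ) (β : τ →₀ ℕ) :
    (Finsupp.sumElim α β).comapDomain Sum.inr Sum.inr_injective.injOn = β := by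
  ext i
  simp

theorem sumElim_eq_zero_iff {α : σ →₀ ℕ} {β : τ →₀ ℕ} :
    Finsupp.sumElim α β = 0 ↔ α = 0 ∧ β = 0 := by
  constructor
  · intro h
    exact ⟨by ext i; simpa using DFunLike.congr_fun h (Sum.inl i),
      by ext i; simpa using DFunLike.congr_fun h (Sum.inr i)⟩
  · rintro ⟨rfl, rfl⟩
    ext (i | i) <;> simp

/-- A power series in two groups of variables as a power series in the first group whose
coefficients are power series in the second. -/
def iterated : MvPowerSeries (σ ⊕ τ) ℂ →+* MvPowerSeries σ (MvPowerSeries τ ℂ) where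
  toFun f := ofCoeff fun α => ofCoeff fun β => coeff (Finsupp.sumElim α β) f
  map_zero' := by
    refine MvPowerSeries.ext fun α => MvPowerSeries.ext fun β => ?_
    simp
  map_add' f g := by
    refine MvPowerSeries.ext fun α => MvPowerSeries.ext fun β => ?_
    simp
  map_one' := by
    classical
    refine MvPowerSeries.ext fun α => MvPowerSeries.ext fun β => ?_
    rw [coeff_ofCoeff, coeff_ofCoeff, coeff_one, coeff_one]
    by_cases hα : α = 0 <;> simp [hα, sumElim_eq_zero_iff, coeff_one]
  map_mul' f g := by
    classical
    refine MvPowerSeries.ext fun α => MvPowerSeries.ext fun β => ?_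
    rw [coeff_ofCoeff, coeff_ofCoeff, coeff_mul, coeff_mul, map_sum]
    simp only [coeff_mul, coeff_ofCoeff]
    rw [Finset.sum_sigma']
    refine Finset.sum_bij' (fun p _ => ⟨(p.1.comapDomain Sum.inl Sum.inl_injective.injOn,
      p.2.comapDomain Sum.inl Sum.inl_injective.injOn),
      (p.1.comapDomain Sum.inr Sum.inr_injective.injOn,
      p.2.comapDomain Sum.inr Sum.inr_injective.injOn)⟩)
      (fun q _ => (Finsupp.sumElim q.1.1 q.2.1, Finsupp.sumElim q.1.2 q.2.2)) ?_ ?_ ?_ ?_ ?_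
    · intro p hp
      rw [Finset.HasAntidiagonal.mem_antidiagonal] at hp
      simp only [Finset.mem_sigma, Finset.HasAntidiagonal.mem_antidiagonal]
      constructor
      · ext i
        simpa using DFunLike.congr_fun hp (Sum.inl i)
      · ext i
        simpa using DFunLike.congr_fun hp (Sum.inr i)
    · intro q hq
      simp only [Finset.mem_sigma, Finset.HasAntidiagonal.mem_antidiagonal] at hq ⊢
      rw [← hq.1, ← hq.2]
      ext (i | i) <;> simp
    · intro p hp
      simp only [sumElim_comapDomain]
    · intro q hq
      simp only [comapDomain_inl_sumElim, comapDomain_inr_sumElim]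
    · intro p hp
      simp only [sumElim_comapDomain]

theorem coeff_coeff_iterated (f : MvPowerSeries (σ ⊕ τ) ℂ) (α : σ →₀ ℕ) (β : τ →₀ ℕ) :
    coeff β (coeff α (iterated f)) = coeff (Finsupp.sumElim α β) f := rfl

theorem iterated_injective : Function.Injective (iterated (σ := σ) (τ := τ)) := by
  intro f g h
  refine MvPowerSeries.ext fun e => ?_
  have := congrArg (fun F => coeff (e.comapDomain Sum.inr Sum.inr_injective.injOn)
    (coeff (e.comapDomain Sum.inl Sum.inl_injective.injOn) F)) h
  simpa only [coeff_coeff_iterated, sumElim_comapDomain] using this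

theorem iterated_surjective : Function.Surjective (iterated (σ := σ) (τ := τ)) := by
  intro F
  refine ⟨ofCoeff fun e => coeff (e.comapDomain Sum.inr Sum.inr_injective.injOn)
    (coeff (e.comapDomain Sum.inl Sum.inl_injective.injOn) F), ?_⟩
  refine MvPowerSeries.ext fun α => MvPowerSeries.ext fun β => ?_
  rw [coeff_coeff_iterated, coeff_ofCoeff, comapDomain_inl_sumElim, comapDomain_inr_sumElim]

theorem iterated_rename_inr [Fintype τ] [Fintype σ] (f : MvPowerSeries τ ℂ) :
    iterated (rename Sum.inr f) = C (σ := σ) f := by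
  classical
  ext α β
  rw [coeff_coeff_iterated, coeff_C]
  by_cases hα : α = 0
  · subst hα
    rw [if_pos rfl]
    have : Finsupp.sumElim (0 : σ →₀ ℕ) β = β.embDomain Function.Embedding.inr := by
      ext (i | i)
      · rw [Finsupp.embDomain_of_notMem_range]
        · simp
        · simp
      · exact (Finsupp.embDomain_apply_self Function.Embedding.inr β i).symm
    rw [this]
    exact coeff_embDomain_rename Function.Embedding.inr f β
  · rw [if_neg hα, map_zero]
    apply coeff_rename_eq_zero
    rintro ⟨γ, hγ⟩
    apply hα
    ext i
    have := DFunLike.congr_fun hγ (Sum.inl i)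
    simp only [Finsupp.sumElim_inl] at this
    rw [← this]
    exact Finsupp.mapDomain_of_notMem_range _ _ (by simp)

/-- The extended ideal is the kernel of the reduction of coefficients onto power series over the
domain `MvPowerSeries τ ℂ ⧸ P`. -/
theorem isPrime_map_rename_inr [Fintype σ] [Fintype τ] (P : Ideal (MvPowerSeries τ ℂ))
    [P.IsPrime] :
    (P.map (rename (Sum.inr : τ → σ ⊕ τ) : MvPowerSeries τ ℂ →ₐ[ℂ] _)).IsPrime := by
  classical
  have hker : P.map (rename (Sum.inr : τ → σ ⊕ τ) : MvPowerSeries τ ℂ →ₐ[ℂ] _) =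
      RingHom.ker ((MvPowerSeries.map (σ := σ) (Ideal.Quotient.mk P)).comp iterated) := by
    apply le_antisymm
    · rw [Ideal.map_le_iff_le_comap]
      intro f hf
      rw [Ideal.mem_comap, RingHom.mem_ker, RingHom.comp_apply, iterated_rename_inr, map_C,
        Ideal.Quotient.eq_zero_iff_mem.2 hf, map_zero]
    · intro f hf
      -- Finitely many generators of `P` let infinitely many coefficientwise memberships assemble
      -- into a finite combination.
      obtain ⟨T, hT⟩ := IsNoetherian.noetherian P
      have hc : ∀ α, coeff α (iterated f) ∈ P := by
        intro α
        have := congrArg (coeff α) (RingHom.mem_ker.1 hf)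
        rwa [RingHom.comp_apply, coeff_map, map_zero, Ideal.Quotient.eq_zero_iff_mem] at this
      have hc' : ∀ α, ∃ c : MvPowerSeries τ ℂ → MvPowerSeries τ ℂ,
          ∑ p ∈ T, c p * p = coeff α (iterated f) := by
        intro α
        have h1 := hc α
        rw [← hT] at h1
        obtain ⟨c, -, hc⟩ := Submodule.mem_span_finset.1 h1
        exact ⟨c, hc⟩
      choose c hc using hc'
      choose g hg using fun p : MvPowerSeries τ ℂ =>
        iterated_surjective (σ := σ) (ofCoeff fun α => c α p)
      have hf' : f = ∑ p ∈ T, g p * rename Sum.inr p := by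
        apply iterated_injective
        rw [map_sum]
        ext1 α
        rw [map_sum, ← hc α]
        refine Finset.sum_congr rfl fun p _ => ?_
        rw [map_mul, hg, iterated_rename_inr, coeff_mul_C, coeff_ofCoeff]
      rw [hf']
      refine sum_mem fun p hp => Ideal.mul_mem_left _ _ (Ideal.mem_map_of_mem _ ?_)
      rw [← hT]
      exact Submodule.subset_span hp
  rw [hker]
  have : IsDomain (MvPowerSeries σ (MvPowerSeries τ ℂ ⧸ P)) := NoZeroDivisors.to_isDomain _
  exact RingHom.ker_isPrime _

end Iterated

/-! ### Functions of `Z`, of `ζ`, and the conjugation exchanging them. -/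

section Conjugation

variable {N : ℕ}

/-- `f(Z)` as a series in `(Z, ζ)`. -/
def holo (N : ℕ) : MvPowerSeries (Fin N) ℂ →ₐ[ℂ] Series N := rename Sum.inl

/-- `f̄(ζ)` as a series in `(Z, ζ)`. -/
def antiholo (N : ℕ) : MvPowerSeries (Fin N) ℂ →+* Series N :=
  (rename (Sum.inr : Fin N → Fin N ⊕ Fin N) : MvPowerSeries (Fin N) ℂ →ₐ[ℂ] Series N).toRingHom.comp
    (MvPowerSeries.map (starRingEnd ℂ))

/-- The involution `f(Z, ζ) ↦ f̄(ζ, Z)`. -/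
def swapConj (N : ℕ) : Series N →+* Series N :=
  (rename (Sum.swap : Fin N ⊕ Fin N → Fin N ⊕ Fin N) : Series N →ₐ[ℂ] Series N).toRingHom.comp
    (MvPowerSeries.map (starRingEnd ℂ))

theorem swapConj_apply (f : Series N) : swapConj N f = swapSeries (conjSeries f) := rfl

theorem antiholo_apply (f : MvPowerSeries (Fin N) ℂ) :
    antiholo N f = rename Sum.inr (conjSeries f) := rfl

theorem conjSeries_conjSeries {σ : Type} (f : MvPowerSeries σ ℂ) :
    conjSeries (conjSeries f) = f := by
  ext e
  simp [conjSeries]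

theorem conjSeries_rename {σ τ : Type} [Fintype σ] [Fintype τ] (u : σ → τ)
    (f : MvPowerSeries σ ℂ) : conjSeries (rename u f) = rename u (conjSeries f) :=
  (rename_map u (starRingEnd ℂ) f).symm

theorem swapConj_holo (f : MvPowerSeries (Fin N) ℂ) : swapConj N (holo N f) = antiholo N f := by
  rw [swapConj_apply, antiholo_apply, holo, conjSeries_rename, swapSeries, rename_rename]
  rfl

theorem swapConj_antiholo (f : MvPowerSeries (Fin N) ℂ) : swapConj N (antiholo N f) = holo N f := by
  rw [swapConj_apply, antiholo_apply, holo, conjSeries_rename, conjSeries_conjSeries, swapSeries,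
    rename_rename]
  rfl

theorem swapConj_X (s : Fin N ⊕ Fin N) : swapConj N (X s) = X s.swap := by
  simp [swapConj_apply, conjSeries, swapSeries]

theorem swapConj_C (c : ℂ) : swapConj N (C c) = C (starRingEnd ℂ c) := by
  simp [swapConj_apply, conjSeries, swapSeries]

theorem constantCoeff_swapConj (f : Series N) :
    constantCoeff (swapConj N f) = starRingEnd ℂ (constantCoeff f) := by
  simp [swapConj_apply, conjSeries, swapSeries]

theorem holo_X (i : Fin N) : holo N (X i) = X (Sum.inl i) := by simp [holo]

theorem antiholo_X (i : Fin N) : antiholo N (X i) = X (Sum.inr i) := by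
  simp [antiholo_apply, conjSeries]

theorem antiholo_C (c : ℂ) : antiholo N (C c) = C (starRingEnd ℂ c) := by
  simp [antiholo_apply, conjSeries]

theorem constantCoeff_holo (f : MvPowerSeries (Fin N) ℂ) :
    constantCoeff (holo N f) = constantCoeff f := by
  simp [holo]

theorem constantCoeff_antiholo (f : MvPowerSeries (Fin N) ℂ) :
    constantCoeff (antiholo N f) = starRingEnd ℂ (constantCoeff f) := by
  simp [antiholo_apply, conjSeries]

theorem derivation_holo (D : Derivation ℂ (Series N) (Series N)) (f : MvPowerSeries (Fin N) ℂ) :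
    D (holo N f) = ∑ i, D (X (Sum.inl i)) * holo N (pderiv ℂ i f) := by
  have := derivation_ringHom (holo N : _ →+* Series N) (fun c => ⟨c, algHom_C (holo N) c⟩)
    (fun i => by simp [constantCoeff_holo]) D f
  simpa [holo_X] using this

theorem derivation_antiholo (D : Derivation ℂ (Series N) (Series N))
    (f : MvPowerSeries (Fin N) ℂ) :
    D (antiholo N f) = ∑ i, D (X (Sum.inr i)) * antiholo N (pderiv ℂ i f) := by
  have := derivation_ringHom (antiholo N) (fun c => ⟨_, antiholo_C c⟩)
    (fun i => by simp [antiholo_X]) D f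
  simpa [antiholo_X] using this

theorem pderiv_swapConj (s : Fin N ⊕ Fin N) (f : Series N) :
    pderiv ℂ s (swapConj N f) = swapConj N (pderiv ℂ s.swap f) := by
  rw [derivation_ringHom (swapConj N) (fun c => ⟨_, swapConj_C c⟩)
    (fun i => by simp [swapConj_X]) (pderiv ℂ s) f, Finset.sum_eq_single s.swap]
  · simp [swapConj_X, pderiv_X_self]
  · intro t _ ht
    rw [swapConj_X, pderiv_X_of_ne, zero_mul]
    rintro rfl
    simp at ht
  · simp

end Conjugation

/-! ### Formal vector fields and their types. -/

section VectorFields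

variable {N : ℕ}

theorem toDerivation_apply (X : VectorField N) (f : Series N) :
    X.toDerivation f = ∑ s, X s * pderiv ℂ s f := by
  rw [VectorField.toDerivation, ← Derivation.coeFnAddMonoidHom_apply, map_sum, Finset.sum_apply]
  rfl

theorem toDerivation_X (Y : VectorField N) (s : Fin N ⊕ Fin N) :
    Y.toDerivation (X s) = Y s := by
  rw [toDerivation_apply, Finset.sum_eq_single s]
  · rw [pderiv_X_self, mul_one]
  · intro t _ ht
    rw [pderiv_X_of_ne ht.symm, mul_zero]
  · simp

theorem type01_holo {Y : VectorField N} (hY : Y.IsType01) (f : MvPowerSeries (Fin N) ℂ) :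
    Y.toDerivation (holo N f) = 0 := by
  rw [derivation_holo]
  exact Finset.sum_eq_zero fun i _ => by rw [toDerivation_X, hY i, zero_mul]

theorem type10_antiholo {Y : VectorField N} (hY : Y.IsType10) (f : MvPowerSeries (Fin N) ℂ) :
    Y.toDerivation (antiholo N f) = 0 := by
  rw [derivation_antiholo]
  exact Finset.sum_eq_zero fun i _ => by rw [toDerivation_X, hY i, zero_mul]

end VectorFields

theorem exists_dual_family {ι V : Type*} [DecidableEq ι] [AddCommGroup V] [Module ℂ V] {b : ι → V}
    (hb : LinearIndependent ℂ b) :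
    ∃ φ : ι → V →ₗ[ℂ] ℂ, ∀ j l, φ j (b l) = if j = l then 1 else 0 := by
  obtain ⟨g, hg⟩ := LinearMap.exists_leftInverse_of_injective (Finsupp.linearCombination ℂ b)
    (LinearMap.ker_eq_bot.2 hb)
  refine ⟨fun j => Finsupp.lapply j ∘ₗ g, fun j l => ?_⟩
  have := LinearMap.congr_fun hg (Finsupp.single l 1)
  rw [LinearMap.comp_apply, Finsupp.linearCombination_single, one_smul] at this
  rw [LinearMap.comp_apply, this]
  simp [Finsupp.single_apply, eq_comm]

/-! ### Vector fields tangent to a generic submanifold. -/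

namespace GenericSubmanifold

variable {N d : ℕ} (M : GenericSubmanifold N d)

theorem rho_mem_ideal (j : Fin d) : M.ρ j ∈ M.ideal := Ideal.subset_span ⟨j, rfl⟩

theorem swapConj_rho (j : Fin d) : swapConj N (M.ρ j) = M.ρ j := (M.real j).symm

theorem map_swapConj_ideal_le : M.ideal.map (swapConj N) ≤ M.ideal := by
  rw [ideal, Ideal.map_span, Ideal.span_le]
  rintro _ ⟨_, ⟨j, rfl⟩, rfl⟩
  rw [swapConj_rho]
  exact M.rho_mem_ideal j

theorem ideal_le_maximalIdeal : M.ideal ≤ maximalIdeal (Series N) := by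
  rw [ideal, Ideal.span_le]
  rintro _ ⟨j, rfl⟩
  exact mem_maximalIdeal_iff.2 (M.zero j)

theorem mem_ideal_mulVec {n : ℕ} (a : Matrix (Fin n) (Fin d) (Series N)) (j : Fin n) :
    a.mulVec M.ρ j ∈ M.ideal := by
  rw [Matrix.mulVec, dotProduct]
  exact sum_mem fun l _ => Ideal.mul_mem_left _ _ (M.rho_mem_ideal l)

theorem derivation_mem_ideal {D : Derivation ℂ (Series N) (Series N)}
    (h : ∀ j, D (M.ρ j) ∈ M.ideal) {f : Series N} (hf : f ∈ M.ideal) : D f ∈ M.ideal := by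
  refine Submodule.span_induction (p := fun f _ => D f ∈ M.ideal) ?_ ?_ ?_ ?_ hf
  · rintro _ ⟨j, rfl⟩
    exact h j
  · rw [map_zero]
    exact M.ideal.zero_mem
  · intro a b _ _ ha hb
    rw [map_add]
    exact add_mem ha hb
  · intro c a ha' ha
    rw [smul_eq_mul, Derivation.leibniz, smul_eq_mul, smul_eq_mul]
    exact add_mem (Ideal.mul_mem_left _ _ ha) (Ideal.mul_mem_right _ _ ha')

theorem Tangent.mem_ideal {M : GenericSubmanifold N d} {Y : VectorField N} (hY : M.Tangent Y)
    {f : Series N} (hf : f ∈ M.ideal) : Y.toDerivation f ∈ M.ideal := by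
  obtain ⟨a, ha⟩ := hY
  refine M.derivation_mem_ideal (fun j => ?_) hf
  rw [congrFun ha j]
  exact M.mem_ideal_mulVec a j

theorem constantCoeff_pderiv_inr (j : Fin d) (i : Fin N) :
    constantCoeff (pderiv ℂ (Sum.inr i) (M.ρ j)) =
      starRingEnd ℂ (constantCoeff (pderiv ℂ (Sum.inl i) (M.ρ j))) := by
  conv_lhs => rw [← M.swapConj_rho j, pderiv_swapConj, constantCoeff_swapConj]
  rfl

/-- Constant vectors of type `(0,1)` dual to the differentials of the defining series. -/
theorem exists_dual_vectors : ∃ y : Fin d → Fin N → ℂ, ∀ j l,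
    ∑ i, y j i * constantCoeff (pderiv ℂ (Sum.inr i) (M.ρ l)) = if j = l then 1 else 0 := by
  obtain ⟨φ, hφ⟩ := exists_dual_family M.generic
  -- By reality the `ζ`-gradients are conjugate to the `Z`-gradients, so the conjugate of a family
  -- dual to the latter serves.
  refine ⟨fun j i => starRingEnd ℂ (φ j (Pi.single i 1)), fun j l => ?_⟩
  have h1 := congrArg (starRingEnd ℂ) (hφ j l)
  rw [LinearMap.pi_apply_eq_sum_univ (φ j), map_sum] at h1
  rw [apply_ite (starRingEnd ℂ), map_one, map_zero] at h1
  rw [← h1]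
  refine Finset.sum_congr rfl fun i _ => ?_
  rw [constantCoeff_pderiv_inr, smul_eq_mul, map_mul, mul_comm]
  congr 1
  change starRingEnd ℂ (φ j (Pi.single i 1)) = _
  congr 2
  funext k
  simp [Pi.single_apply, eq_comm]

/-- Any vector field becomes tangent after the addition of a field of type `(0,1)`. -/
theorem exists_tangent_correction (Y : VectorField N) :
    ∃ W : VectorField N, W.IsType01 ∧ M.Tangent (Y - W) ∧
      ((∀ j, constantCoeff (Y.toDerivation (M.ρ j)) = 0) →
        ∀ s, constantCoeff (W s) = 0) := by
  classical
  obtain ⟨y, hy⟩ := M.exists_dual_vectors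
  let V : Fin d → VectorField N := fun j => Sum.elim 0 fun i => C (y j i)
  -- `G` is the identity at `0`, hence invertible over power series, and `Wρ = Yρ` can be solved
  -- exactly by a combination of the `V j`.
  let G : Matrix (Fin d) (Fin d) (Series N) :=
    Matrix.of fun j l => (V j).toDerivation (M.ρ l)
  have hG0 : G.map (constantCoeff (σ := Fin N ⊕ Fin N) (R := ℂ)) = 1 := by
    ext j l
    rw [Matrix.map_apply, show G j l = (V j).toDerivation (M.ρ l) from rfl, toDerivation_apply, Fintype.sum_sum_type]
    simp only [V, Sum.elim_inl, Sum.elim_inr, Pi.zero_apply, zero_mul, Finset.sum_const_zero,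
      zero_add, map_sum, map_mul, constantCoeff_C]
    rw [hy, Matrix.one_apply]
  have hG : IsUnit G.det := by
    rw [MvPowerSeries.isUnit_iff_constantCoeff, RingHom.map_det, RingHom.mapMatrix_apply, hG0,
      Matrix.det_one]
    exact isUnit_one
  let g : Fin d → Series N := Matrix.vecMul (fun l => Y.toDerivation (M.ρ l)) G⁻¹
  have hg : Matrix.vecMul g G = fun l => Y.toDerivation (M.ρ l) := by
    rw [Matrix.vecMul_vecMul, Matrix.nonsing_inv_mul _ hG, Matrix.vecMul_one]
  let W : VectorField N := ∑ j, g j • V j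
  have hW : ∀ l, W.toDerivation (M.ρ l) = Y.toDerivation (M.ρ l) := by
    intro l
    rw [← congrFun hg l]
    simp only [toDerivation_apply, W, Matrix.vecMul, dotProduct, G, Matrix.of_apply,
      Finset.sum_apply, Pi.smul_apply, smul_eq_mul, Finset.sum_mul, Finset.mul_sum, mul_assoc]
    exact Finset.sum_comm
  refine ⟨W, ?_, ⟨0, ?_⟩, ?_⟩
  · intro i
    simp [W, V]
  · funext l
    rw [Matrix.zero_mulVec, Pi.zero_apply]
    have : (Y - W).toDerivation (M.ρ l) = Y.toDerivation (M.ρ l) - W.toDerivation (M.ρ l) := by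
      simp only [toDerivation_apply, Pi.sub_apply, sub_mul, Finset.sum_sub_distrib]
    rw [this, hW, sub_self]
  · intro h0 s
    simp only [W, Finset.sum_apply, Pi.smul_apply, smul_eq_mul, map_sum, map_mul]
    refine Finset.sum_eq_zero fun j _ => ?_
    have : constantCoeff (g j) = 0 := by
      simp only [g, Matrix.vecMul, dotProduct, map_sum, map_mul, h0, zero_mul,
        Finset.sum_const_zero]
    rw [this, zero_mul]

/-- Tangent vector fields that act on functions of `Z` as the partial derivatives. -/
theorem exists_tangent_lift (i : Fin N) : ∃ Y : VectorField N, M.Tangent Y ∧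
    ∀ f, Y.toDerivation (holo N f) = holo N (pderiv ℂ i f) := by
  classical
  obtain ⟨W, hW, hT, -⟩ := M.exists_tangent_correction (Pi.single (Sum.inl i) 1)
  refine ⟨_, hT, fun f => ?_⟩
  rw [derivation_holo, Finset.sum_eq_single i]
  · simp [toDerivation_X, hW i]
  · intro k _ hk
    simp [toDerivation_X, hW k, hk]
  · simp

theorem exists_tangent_type01 {v : Fin N ⊕ Fin N → ℂ} (hv : ∀ i, v (Sum.inl i) = 0)
    (hv' : v ∈ tangentSpace M.ρ) : ∃ Y : VectorField N, M.Tangent Y ∧ Y.IsType01 ∧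
      ∀ s, constantCoeff (Y s) = v s := by
  obtain ⟨W, hW, hT, h0⟩ := M.exists_tangent_correction fun s => C (v s)
  refine ⟨_, hT, fun i => by simp [hv, hW i], fun s => ?_⟩
  have := h0 (fun j => by
    rw [toDerivation_apply, map_sum]
    simpa using hv' j) s
  simp [this]

/-- The tangent lifts make the contraction of the ideal to functions of `Z` stable under all partial
derivatives, so every derivative of `f` vanishes at `0`. -/
theorem holo_mem_ideal {f : MvPowerSeries (Fin N) ℂ} (hf : holo N f ∈ M.ideal) : f = 0 := by
  choose Y hT hY using M.exists_tangent_lift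
  have hJ : ∀ v : Fin N → ℂ, ∀ g ∈ M.ideal.comap (holo N),
      dirDeriv v g ∈ M.ideal.comap (holo N) := by
    intro v g hg
    rw [dirDeriv_apply]
    refine sum_mem fun i _ => ?_
    rw [smul_eq_C_mul]
    refine Ideal.mul_mem_left _ _ ?_
    rw [Ideal.mem_comap, ← hY]
    exact (hT i).mem_ideal hg
  have h1 : f ∈ (⊥ : Ideal (MvPowerSeries (Fin N) ℂ)) := by
    apply mem_of_forall_mem_sup_pow
    intro n
    -- With the empty family of equations the tangent space is everything, and the criterion says
    -- that a series with all derivatives zero at `0` is zero.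
    have hw : Ideal.span (Set.range (Empty.elim : Empty → MvPowerSeries (Fin N) ℂ)) = ⊥ := by
      simp
    rw [← hw]
    refine mem_sup_of_applyWord (h := AlgHom.id ℂ _) (by simp) (fun s => by simp)
      (fun v => dirDeriv v) (fun v s => by simp [dirDeriv_X]) ⊥ bot_le (by simp) (by simp) n ?_
    intro l _
    have h2 := applyWord_mem (fun v : tangentSpace (Empty.elim : Empty → MvPowerSeries (Fin N) ℂ) =>
      dirDeriv (v : Fin N → ℂ)) l (fun v _ => hJ v) (Ideal.mem_comap.2 hf)
    have h3 := mem_maximalIdeal_iff.1 (M.ideal_le_maximalIdeal (Ideal.mem_comap.1 h2))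
    rwa [constantCoeff_holo] at h3
  exact h1

end GenericSubmanifold

/-! ### Primality in straightened coordinates. -/

theorem algHom_eq {σ τ : Type} [Fintype σ] [Fintype τ]
    {h k : MvPowerSeries σ ℂ →ₐ[ℂ] MvPowerSeries τ ℂ}
    (hX : ∀ s, constantCoeff (k (X s)) = 0) (hk : ∀ s, h (X s) = k (X s))
    (f : MvPowerSeries σ ℂ) : h f = k f := by
  have := algHom_sub_mem (h := h) (k := k) (q := ⊥) hX (fun s => by simp [hk s]) f
  rwa [Ideal.mem_bot, sub_eq_zero] at this

/-- The substitution of series without constant terms. -/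
def substHom {σ τ : Type} [Fintype σ] (y : σ → MvPowerSeries τ ℂ)
    (hy : ∀ s, constantCoeff (y s) = 0) : MvPowerSeries σ ℂ →ₐ[ℂ] MvPowerSeries τ ℂ :=
  substAlgHom (hasSubst_of_constantCoeff_zero hy)

theorem substHom_X {σ τ : Type} [Fintype σ] (y : σ → MvPowerSeries τ ℂ)
    (hy : ∀ s, constantCoeff (y s) = 0) (s : σ) : substHom y hy (X s) = y s :=
  substAlgHom_X _ s

/-- Setting the `σ₁` variables to zero is the map `k`; the ideal is the preimage under `k` of the
extension of `P`. -/
theorem isPrime_span_X_sup {σ₁ σ₂ τ : Type} [Fintype σ₁] [Fintype σ₂] [Fintype τ]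
    (P : Ideal (MvPowerSeries τ ℂ)) [P.IsPrime] :
    (Ideal.span (Set.range fun i : σ₁ =>
      (X (Sum.inl (Sum.inl i)) : MvPowerSeries ((σ₁ ⊕ σ₂) ⊕ τ) ℂ)) ⊔
      P.map (rename (Sum.inr : τ → (σ₁ ⊕ σ₂) ⊕ τ) : MvPowerSeries τ ℂ →ₐ[ℂ] _)).IsPrime := by
  let y : (σ₁ ⊕ σ₂) ⊕ τ → MvPowerSeries ((σ₁ ⊕ σ₂) ⊕ τ) ℂ :=
    Sum.elim (Sum.elim 0 fun i => X (Sum.inl (Sum.inr i))) fun i => X (Sum.inr i)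
  have hy : ∀ s, constantCoeff (y s) = 0 := by
    rintro ((i | i) | i) <;> simp [y]
  let k := substHom y hy
  set q := Ideal.span (Set.range fun i : σ₁ =>
      (X (Sum.inl (Sum.inl i)) : MvPowerSeries ((σ₁ ⊕ σ₂) ⊕ τ) ℂ)) with hq
  set P' := P.map (rename (Sum.inr : τ → (σ₁ ⊕ σ₂) ⊕ τ) : MvPowerSeries τ ℂ →ₐ[ℂ] _) with hP'
  have hk : ∀ f, f - k f ∈ q := by
    refine algHom_sub_mem (h := AlgHom.id ℂ _) (k := k) (fun s => ?_) (fun s => ?_)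
    · rw [substHom_X, hy]
    · rw [AlgHom.id_apply, substHom_X]
      obtain ((i | i) | i) := s
      · have h1 : (X (Sum.inl (Sum.inl i)) : MvPowerSeries ((σ₁ ⊕ σ₂) ⊕ τ) ℂ) ∈ q :=
          Ideal.subset_span ⟨i, rfl⟩
        simpa [y] using h1
      · simp [y]
      · simp [y]
  have hkr : ∀ f : MvPowerSeries τ ℂ, k (rename Sum.inr f) = rename Sum.inr f := by
    refine algHom_eq (h := k.comp (rename Sum.inr)) (k := rename Sum.inr) (fun s => by simp) ?_
    intro s
    rw [AlgHom.comp_apply, rename_X, substHom_X]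
    rfl
  have heq : q ⊔ P' = P'.comap k := by
    apply le_antisymm
    · refine sup_le ?_ ?_
      · rw [hq, Ideal.span_le]
        rintro _ ⟨i, rfl⟩
        change k (X _) ∈ P'
        rw [substHom_X]
        exact P'.zero_mem
      · rw [hP', Ideal.map_le_iff_le_comap]
        intro f hf
        rw [Ideal.mem_comap, Ideal.mem_comap, hkr]
        exact Ideal.mem_map_of_mem _ hf
    · intro f hf
      have := add_mem (Ideal.mem_sup_left (hk f)) (Ideal.mem_sup_right (S := q) (Ideal.mem_comap.1 hf))
      rwa [sub_add_cancel] at this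
  rw [heq]
  have : P'.IsPrime := isPrime_map_rename_inr P
  exact Ideal.comap_isPrime k P'

namespace GenericSubmanifold

variable {N d : ℕ} (M : GenericSubmanifold N d)

/-- A formal change of coordinates fixing `ζ` turns the `ρ j` into variables, which reduces to
`isPrime_span_X_sup`. -/
theorem isPrime_ideal_sup_map_rename (P : Ideal (MvPowerSeries (Fin N) ℂ)) [P.IsPrime] :
    (M.ideal ⊔ P.map (rename (Sum.inr : Fin N → Fin N ⊕ Fin N) :
      MvPowerSeries (Fin N) ℂ →ₐ[ℂ] Series N)).IsPrime := by
  classical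
  -- The gradients of `ρ` at `0` are completed to a basis; the added vectors, indexed by `κ`, supply
  -- linear functions of `Z` completing the coordinate system.
  let b := Module.Basis.sumExtend M.generic
  have hb : ∀ j, b (Sum.inl j) = fun i => constantCoeff (pderiv ℂ (Sum.inl i) (M.ρ j)) := by
    intro j
    simp only [b, Module.Basis.sumExtend, Module.Basis.reindex_apply]
    rw [Module.Basis.extend_apply_self]
    rfl
  let κ := Module.Basis.sumExtendIndex M.generic
  have hfin : Finite (Fin d ⊕ κ) := Module.Finite.finite_basis b
  have : Finite κ := Finite.of_injective (Sum.inr : κ → Fin d ⊕ κ) Sum.inr_injective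
  have : Fintype κ := Fintype.ofFinite κ
  have hcard : Fintype.card (Fin d ⊕ κ) = Fintype.card (Fin N) := by
    rw [← Module.finrank_eq_card_basis b, Module.finrank_fin_fun, Fintype.card_fin]
  let e : (Fin d ⊕ κ) ⊕ Fin N ≃ Fin N ⊕ Fin N :=
    (Fintype.equivOfCardEq hcard).sumCongr (Equiv.refl _)
  let lin : (Fin N → ℂ) →ₗ[ℂ] Series N :=
    { toFun := fun c => ∑ i, C (c i) * X (Sum.inl i)
      map_add' := fun a c => by simp [add_mul, Finset.sum_add_distrib]
      map_smul' := fun a c => by simp [Finset.smul_sum, smul_eq_C_mul, mul_assoc] }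
  let y : (Fin d ⊕ κ) ⊕ Fin N → Series N :=
    Sum.elim (Sum.elim M.ρ fun k => lin (b (Sum.inr k))) fun i => X (Sum.inr i)
  have hy : ∀ s, constantCoeff (y s) = 0 := by
    rintro ((j | k) | i)
    · exact M.zero j
    · simp [y, lin]
    · simp [y]
  let φ := substHom y hy
  have hspan : maximalIdeal (Series N) ≤
      Ideal.span (Set.range fun s => φ (X s)) ⊔ maximalIdeal (Series N) ^ 2 := by
    have hφ : (fun s => φ (X s)) = y := funext fun s => substHom_X y hy s
    rw [hφ]
    set q := Ideal.span (Set.range y) with hq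
    have hyq : ∀ s, y s ∈ q ⊔ maximalIdeal (Series N) ^ 2 :=
      fun s => Ideal.mem_sup_left (Ideal.subset_span ⟨s, rfl⟩)
    have hlin : ∀ c, lin c ∈ q ⊔ maximalIdeal (Series N) ^ 2 := by
      intro c
      rw [← b.sum_repr c, map_sum]
      refine sum_mem fun s _ => ?_
      rw [map_smul, smul_eq_C_mul]
      refine Ideal.mul_mem_left _ _ ?_
      obtain j | k := s
      · have h1 := sub_linear_mem_sq (M.ρ j)
        rw [M.zero j, map_zero, sub_zero, Fintype.sum_sum_type] at h1
        have h2 : lin (b (Sum.inl j)) =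
            ∑ i, C (constantCoeff (pderiv ℂ (Sum.inl i) (M.ρ j))) * X (Sum.inl i) := by
          rw [hb]
          rfl
        rw [← h2] at h1
        have h3 : ∑ i, C (constantCoeff (pderiv ℂ (Sum.inr i) (M.ρ j))) * X (Sum.inr i) ∈
            q ⊔ maximalIdeal (Series N) ^ 2 :=
          sum_mem fun i _ => Ideal.mul_mem_left _ _ (hyq (Sum.inr i))
        have h4 := sub_mem (sub_mem (hyq (Sum.inl (Sum.inl j))) h3)
          (Ideal.mem_sup_right (S := q) h1)
        convert h4 using 1
        simp only [y, Sum.elim_inl]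
        ring
      · exact hyq (Sum.inl (Sum.inr k))
    rw [maximalIdeal_eq_span, Ideal.span_le, ← maximalIdeal_eq_span]
    rintro _ ⟨i | i, rfl⟩
    · have h1 := hlin (Pi.single i 1)
      have h2 : lin (Pi.single i 1) = X (Sum.inl i) := by
        simp only [lin, LinearMap.coe_mk, AddHom.coe_mk]
        rw [Finset.sum_eq_single i]
        · simp
        · intro k _ hk
          simp [hk]
        · simp
      rwa [h2] at h1
    · exact hyq (Sum.inr i)
  have hbij := algHom_bijective e φ (fun s => by rw [substHom_X, hy]) hspan
  have hφr : ∀ f : MvPowerSeries (Fin N) ℂ, φ (rename Sum.inr f) = rename Sum.inr f := by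
    refine algHom_eq (h := φ.comp (rename Sum.inr)) (k := rename Sum.inr) (fun s => by simp) ?_
    intro s
    rw [AlgHom.comp_apply, rename_X, substHom_X]
    simp [y]
  have heq : M.ideal ⊔ P.map (rename (Sum.inr : Fin N → Fin N ⊕ Fin N) :
      MvPowerSeries (Fin N) ℂ →ₐ[ℂ] Series N) = (Ideal.span (Set.range fun i : Fin d =>
      (X (Sum.inl (Sum.inl i)) : MvPowerSeries ((Fin d ⊕ κ) ⊕ Fin N) ℂ)) ⊔
      P.map (rename (Sum.inr : Fin N → (Fin d ⊕ κ) ⊕ Fin N) :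
        MvPowerSeries (Fin N) ℂ →ₐ[ℂ] _)).map φ := by
    rw [Ideal.map_sup, Ideal.map_span, ← Set.range_comp]
    congr 1
    · rw [ideal]
      congr 2
      funext j
      exact (substHom_X y hy (Sum.inl (Sum.inl j))).symm
    · apply le_antisymm
      · rw [Ideal.map_le_iff_le_comap]
        intro f hf
        rw [Ideal.mem_comap, ← hφr]
        exact Ideal.mem_map_of_mem _ (Ideal.mem_map_of_mem _ hf)
      · rw [Ideal.map_le_iff_le_comap, Ideal.map_le_iff_le_comap]
        intro f hf
        rw [Ideal.mem_comap, Ideal.mem_comap, hφr]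
        exact Ideal.mem_map_of_mem _ hf
  rw [heq]
  have := isPrime_span_X_sup (σ₁ := Fin d) (σ₂ := κ) P
  refine Ideal.map_isPrime_of_surjective (f := φ) hbij.2 ?_
  rw [(RingHom.injective_iff_ker_eq_bot φ).1 hbij.1]
  exact bot_le

theorem isPrime_ideal_sup_map_antiholo (P : Ideal (MvPowerSeries (Fin N) ℂ)) [P.IsPrime] :
    (M.ideal ⊔ P.map (antiholo N)).IsPrime := by
  -- Conjugating coefficients is an involution, so this is the extension of the conjugate prime.
  have h1 : P.map (antiholo N) = (P.comap (MvPowerSeries.map (starRingEnd ℂ))).map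
      (rename (Sum.inr : Fin N → Fin N ⊕ Fin N) :
        MvPowerSeries (Fin N) ℂ →ₐ[ℂ] Series N) := by
    apply le_antisymm
    · rw [Ideal.map_le_iff_le_comap]
      intro f hf
      rw [Ideal.mem_comap, antiholo_apply]
      refine Ideal.mem_map_of_mem _ ?_
      rw [Ideal.mem_comap]
      change conjSeries (conjSeries f) ∈ P
      rwa [conjSeries_conjSeries]
    · rw [Ideal.map_le_iff_le_comap]
      intro f hf
      rw [Ideal.mem_comap, ← conjSeries_conjSeries f, ← antiholo_apply]
      exact Ideal.mem_map_of_mem _ hf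
  rw [h1]
  exact M.isPrime_ideal_sup_map_rename _

/-! ### Segre ideals: primality, monotonicity, and the height of the first. -/

/-- The ideals of the iterated Segre sets: the functions of `Z` that vanish on the projection of
the part of `M` lying over the conjugate of the preceding set. -/
def segreIdeal : ℕ → Ideal (MvPowerSeries (Fin N) ℂ)
  | 0 => maximalIdeal _
  | k + 1 => (M.ideal ⊔ (segreIdeal k).map (antiholo N)).comap (holo N)

theorem mem_segreIdeal_succ {k : ℕ} {f : MvPowerSeries (Fin N) ℂ} :
    f ∈ M.segreIdeal (k + 1) ↔ holo N f ∈ M.ideal ⊔ (M.segreIdeal k).map (antiholo N) := Iff.rfl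

theorem isPrime_segreIdeal (k : ℕ) : (M.segreIdeal k).IsPrime := by
  induction k with
  | zero => exact (maximalIdeal.isMaximal _).isPrime
  | succ k ih =>
    have := M.isPrime_ideal_sup_map_antiholo (M.segreIdeal k)
    exact Ideal.comap_isPrime (holo N) _

theorem segreIdeal_succ_le (k : ℕ) : M.segreIdeal (k + 1) ≤ M.segreIdeal k := by
  induction k with
  | zero => exact IsLocalRing.le_maximalIdeal (M.isPrime_segreIdeal 1).ne_top
  | succ k ih => exact Ideal.comap_mono (sup_le_sup le_rfl (Ideal.map_mono ih))

/-- Setting `ζ = 0` by `ev` shows that the generators are the series `ρ_j(Z, 0)`. -/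
theorem segreIdeal_one : ∃ y : Fin d → MvPowerSeries (Fin N) ℂ,
    M.segreIdeal 1 = Ideal.span (Set.range y) := by
  let ev : Series N →ₐ[ℂ] MvPowerSeries (Fin N) ℂ := killCompl Function.Embedding.inl
  have hev : ∀ f, ev (holo N f) = f := fun f => killCompl_rename_app f
  have hl : ∀ i, ev (X (Sum.inl i)) = X i := fun i => killCompl_X (e := Function.Embedding.inl) i
  have hr : ∀ i, ev (X (Sum.inr i)) = 0 := fun i => killCompl_X_eq_zero (by simp)
  set q := (maximalIdeal (MvPowerSeries (Fin N) ℂ)).map (antiholo N) with hq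
  have hXq : ∀ i, (X (Sum.inr i) : Series N) ∈ q := by
    intro i
    rw [← antiholo_X]
    exact Ideal.mem_map_of_mem _ (mem_maximalIdeal_iff.2 (by simp))
  have hqspan : q ≤ RingHom.ker ev := by
    rw [hq, maximalIdeal_eq_span, Ideal.map_span, Ideal.span_le]
    rintro _ ⟨_, ⟨i, rfl⟩, rfl⟩
    rw [antiholo_X]
    exact hr i
  have hsub : ∀ f, f - holo N (ev f) ∈ q := by
    refine algHom_sub_mem (h := AlgHom.id ℂ _) (k := (holo N).comp ev) (fun s => ?_) (fun s => ?_)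
    · obtain i | i := s <;> simp [hl, hr, holo_X]
    · obtain i | i := s
      · simp [hl, holo_X]
      · simpa [hr] using hXq i
  refine ⟨fun j => ev (M.ρ j), le_antisymm ?_ ?_⟩
  · intro f hf
    have h1 : ev (holo N f) ∈ (M.ideal ⊔ q).map ev := Ideal.mem_map_of_mem ev hf
    rw [hev, Ideal.map_sup, (Ideal.map_eq_bot_iff_le_ker _).2 hqspan, sup_bot_eq, ideal,
      Ideal.map_span, ← Set.range_comp] at h1
    exact h1
  · rw [Ideal.span_le]
    rintro _ ⟨j, rfl⟩
    change holo N (ev (M.ρ j)) ∈ M.ideal ⊔ q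
    have := sub_mem (Ideal.mem_sup_left (T := q) (M.rho_mem_ideal j))
      (Ideal.mem_sup_right (S := M.ideal) (hsub (M.ρ j)))
    rwa [sub_sub_cancel] at this

/-- Krull's height theorem for a prime with `d` generators. -/
theorem height_segreIdeal_one_le : (M.segreIdeal 1).height ≤ d := by
  classical
  obtain ⟨y, hy⟩ := M.segreIdeal_one
  have hp := M.isPrime_segreIdeal 1
  have h1 : M.segreIdeal 1 ∈ (Ideal.span ((Finset.univ.image y : Finset _) :
      Set (MvPowerSeries (Fin N) ℂ))).minimalPrimes := by
    rw [Finset.coe_image, Finset.coe_univ, Set.image_univ, ← hy,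
      Ideal.minimalPrimes_eq_subsingleton_self]
    rfl
  refine (Ideal.height_le_card_of_mem_minimalPrimes_span_finset h1).trans ?_
  have := Finset.card_image_le (s := Finset.univ) (f := y)
  rw [Finset.card_univ, Fintype.card_fin] at this
  exact_mod_cast this

end GenericSubmanifold

/-! ### Finite type and the vanishing of the Segre ideals. -/

/-- The derivations that preserve an ideal. -/
def stabilizer {A : Type*} [CommRing A] [Algebra ℂ A] (q : Ideal A) :
    LieSubalgebra ℂ (Derivation ℂ A A) where
  carrier := {D | ∀ f ∈ q, D f ∈ q}
  add_mem' {D E} hD hE f hf := add_mem (hD f hf) (hE f hf)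
  zero_mem' f _ := q.zero_mem
  smul_mem' c D hD f hf := by
    rw [Derivation.smul_apply, Algebra.smul_def]
    exact Ideal.mul_mem_left _ _ (hD f hf)
  lie_mem' {D E} hD hE f hf := by
    rw [Derivation.commutator_apply]
    exact sub_mem (hD _ (hE f hf)) (hE _ (hD f hf))

/-- The source and target ideals differ so that a generating set suited to `D` may be chosen, and so
that derivations enlarging an ideal are covered too. -/
theorem derivation_mem_of_span {A : Type*} [CommRing A] [Algebra ℂ A] {S : Set A} {p q : Ideal A}
    (hS : Ideal.span S ≤ q) (D : Derivation ℂ A A) (hp : ∀ f ∈ p, D f ∈ q)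
    (h : ∀ f ∈ S, D f ∈ q) {f : A} (hf : f ∈ p ⊔ Ideal.span S) : D f ∈ q := by
  obtain ⟨a, ha, b, hb, rfl⟩ := Submodule.mem_sup.1 hf
  rw [map_add]
  refine add_mem (hp a ha) ?_
  refine Submodule.span_induction (p := fun f _ => D f ∈ q) h ?_ ?_ ?_ hb
  · rw [map_zero]
    exact q.zero_mem
  · intro a b _ _ ha hb
    rw [map_add]
    exact add_mem ha hb
  · intro c a ha' ha
    rw [smul_eq_mul, Derivation.leibniz, smul_eq_mul, smul_eq_mul]
    exact add_mem (Ideal.mul_mem_left _ _ ha) (Ideal.mul_mem_right _ _ (hS ha'))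

namespace GenericSubmanifold

variable {N d : ℕ} (M : GenericSubmanifold N d)

theorem lieAlgebra_le_stabilizer {q : Ideal (Series N)}
    (h : ∀ Y : VectorField N, M.Tangent Y → Y.IsType01 ∨ Y.IsType10 →
      ∀ f ∈ q, Y.toDerivation f ∈ q) : M.lieAlgebra ≤ stabilizer q := by
  rw [lieAlgebra, LieSubalgebra.lieSpan_le]
  rintro _ ⟨Y, hY, rfl⟩
  refine Submodule.span_induction
    (p := fun Y _ => Y.toDerivation ∈ stabilizer q) ?_ ?_ ?_ ?_ hY
  · rintro Y ⟨hT, hY⟩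
    exact h Y hT hY
  · intro f _
    rw [toDerivation_apply]
    simp
  · intro Y W _ _ hY hW f hf
    have : (Y + W).toDerivation f = Y.toDerivation f + W.toDerivation f := by
      simp only [toDerivation_apply, Pi.add_apply, add_mul, Finset.sum_add_distrib]
    rw [this]
    exact add_mem (hY f hf) (hW f hf)
  · intro c Y _ hY f hf
    have : (c • Y).toDerivation f = c * Y.toDerivation f := by
      simp only [toDerivation_apply, Pi.smul_apply, smul_eq_mul, Finset.mul_sum, mul_assoc]
    rw [this]
    exact Ideal.mul_mem_left _ _ (hY f hf)

theorem lieAlgebra_mem_ideal {D : Derivation ℂ (Series N) (Series N)} (hD : D ∈ M.lieAlgebra)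
    {f : Series N} (hf : f ∈ M.ideal) : D f ∈ M.ideal :=
  M.lieAlgebra_le_stabilizer (fun _ hT _ _ hf => hT.mem_ideal hf) hD f hf

theorem finrank_tangentSpace_le : Module.finrank ℂ (tangentSpace M.ρ) + d ≤ 2 * N := by
  classical
  let F : (Fin N ⊕ Fin N → ℂ) →ₗ[ℂ] (Fin d → ℂ) := LinearMap.pi fun j => differential (M.ρ j)
  have hker : LinearMap.ker F = tangentSpace M.ρ := by
    ext v
    rw [LinearMap.mem_ker, mem_tangentSpace, funext_iff]
    simp [F, differential_apply]
  have hsurj : LinearMap.range F = ⊤ := by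
    rw [LinearMap.range_eq_top]
    intro c
    obtain ⟨y, hy⟩ := M.exists_dual_vectors
    refine ⟨∑ j, c j • Sum.elim (0 : Fin N → ℂ) (y j), ?_⟩
    funext l
    simp only [F, LinearMap.pi_apply, map_sum, map_smul, differential_apply, Fintype.sum_sum_type,
      Sum.elim_inl, Sum.elim_inr, Pi.zero_apply, zero_mul, Finset.sum_const_zero, zero_add, hy]
    simp
  have h1 := LinearMap.finrank_range_add_finrank_ker F
  rw [hker, hsurj, finrank_top, Module.finrank_fin_fun, Module.finrank_fintype_fun_eq_card,
    Fintype.card_sum, Fintype.card_fin] at h1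
  omega

/-- Brackets of tangent fields remain tangent, which gives one inclusion; finite type says that the
dimensions match. -/
theorem lieAlgebraAtZero_eq (hM : M.FiniteType) : M.lieAlgebraAtZero = tangentSpace M.ρ := by
  apply Submodule.eq_of_le_of_finrank_le
  · rintro _ ⟨D, hD, rfl⟩ j
    have h1 := mem_maximalIdeal_iff.1
      (M.ideal_le_maximalIdeal (M.lieAlgebra_mem_ideal hD (M.rho_mem_ideal j)))
    rwa [constantCoeff_derivation] at h1
  · have h1 := M.finrank_tangentSpace_le
    have h2 : Module.finrank ℂ M.lieAlgebraAtZero + d = 2 * N := hM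
    omega

/-- Elements of `𝔤_M` through every tangent vector preserve `q`, so all their words applied to `f ∈
q` vanish at `0`; such an `f` lies in the ideal of `M` modulo every power of the maximal ideal. -/
theorem le_ideal_of_finiteType (hM : M.FiniteType) {q : Ideal (Series N)}
    (hq : q ≤ maximalIdeal (Series N))
    (h : ∀ Y : VectorField N, M.Tangent Y → Y.IsType01 ∨ Y.IsType10 →
      ∀ f ∈ q, Y.toDerivation f ∈ q) : q ≤ M.ideal := by
  intro f hf
  have hD : ∀ v : tangentSpace M.ρ, ∃ D ∈ M.lieAlgebra, evalZero N D = v := by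
    rintro ⟨v, hv⟩
    rw [← M.lieAlgebraAtZero_eq hM] at hv
    exact hv
  choose D hD hDv using hD
  apply mem_of_forall_mem_sup_pow
  intro n
  refine mem_sup_of_applyWord (h := AlgHom.id ℂ _) M.zero (by simp) D
    (fun v s => congrFun (hDv v) s) M.ideal M.ideal_le_maximalIdeal
    (fun v f hf => M.lieAlgebra_mem_ideal (hD v) hf) M.rho_mem_ideal n ?_
  intro l _
  exact mem_maximalIdeal_iff.1 (hq (applyWord_mem D l
    (fun v _ => M.lieAlgebra_le_stabilizer h (hD v)) hf))

/-- Stationarity makes the ideal `q` symmetric in `Z` and `ζ`, hence stable under tangent fields of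
both types. -/
theorem segreIdeal_eq_bot_of_le (hM : M.FiniteType) {k : ℕ}
    (hk : M.segreIdeal k ≤ M.segreIdeal (k + 1)) : M.segreIdeal k = ⊥ := by
  set J := M.segreIdeal k with hJ
  set q := M.ideal ⊔ J.map (antiholo N) with hq
  have h1 : J.map (holo N) ≤ q := Ideal.map_le_iff_le_comap.2 hk
  -- The nontrivial inclusion is the image of `h1` under the involution `swapConj`.
  have hqs : q = M.ideal ⊔ J.map (holo N) := by
    apply le_antisymm
    · refine sup_le le_sup_left ?_
      have h2 : (J.map (holo N)).map (swapConj N) ≤ q.map (swapConj N) := Ideal.map_mono h1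
      rw [Ideal.map_le_iff_le_comap]
      intro f hf
      have h3 : antiholo N f ∈ q.map (swapConj N) := by
        rw [← swapConj_holo]
        exact h2 (Ideal.mem_map_of_mem _ (Ideal.mem_map_of_mem _ hf))
      have h4 : q.map (swapConj N) ≤ M.ideal ⊔ J.map (holo N) := by
        rw [hq, Ideal.map_sup]
        refine sup_le_sup M.map_swapConj_ideal_le ?_
        rw [Ideal.map_le_iff_le_comap, Ideal.map_le_iff_le_comap]
        intro g hg
        rw [Ideal.mem_comap, Ideal.mem_comap, swapConj_antiholo]
        exact Ideal.mem_map_of_mem _ hg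
      exact h4 h3
    · exact sup_le le_sup_left h1
  have hqle : q ≤ M.ideal := by
    refine M.le_ideal_of_finiteType hM ?_ ?_
    · have := M.isPrime_segreIdeal k
      exact IsLocalRing.le_maximalIdeal (M.isPrime_ideal_sup_map_antiholo J).ne_top
    -- A `(0,1)` field kills the generators in `Z`, a `(1,0)` field those in `ζ`.
    · rintro Y hT (hY | hY) f hf
      · rw [hqs] at hf
        refine derivation_mem_of_span h1 _
          (fun f hf => Ideal.mem_sup_left (hT.mem_ideal hf)) ?_ hf
        rintro _ ⟨g, _, rfl⟩
        have h0 : Y.toDerivation (holo N g) = 0 := type01_holo hY g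
        exact h0 ▸ q.zero_mem
      · refine derivation_mem_of_span le_sup_right _
          (fun f hf => Ideal.mem_sup_left (hT.mem_ideal hf)) ?_ hf
        rintro _ ⟨g, _, rfl⟩
        rw [type10_antiholo hY]
        exact q.zero_mem
  rw [eq_bot_iff]
  intro f hf
  exact M.holo_mem_ideal (hqle (hk hf))

/-- Otherwise `0 < S_{d+1} < ⋯ < S₁` is a strict chain of primes, forcing the height of `S₁` up to
`d + 1`. -/
theorem segreIdeal_eq_bot (hM : M.FiniteType) : M.segreIdeal (d + 1) = ⊥ := by
  by_contra hne
  have hmono : ∀ k i, M.segreIdeal (k + i) ≤ M.segreIdeal k := by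
    intro k i
    induction i with
    | zero => exact le_rfl
    | succ i ih => exact (M.segreIdeal_succ_le (k + i)).trans ih
  have hlt : ∀ k ≤ d, M.segreIdeal (k + 1) < M.segreIdeal k := by
    intro k hk
    refine lt_of_le_not_ge (M.segreIdeal_succ_le k) fun h => hne ?_
    rw [eq_bot_iff, ← M.segreIdeal_eq_bot_of_le hM h]
    obtain ⟨i, hi⟩ := Nat.exists_eq_add_of_le (hk.trans (Nat.le_succ d))
    have := hmono k i
    rwa [← hi] at this
  have hheight : ∀ i ≤ d, ((i + 1 : ℕ) : ℕ∞) ≤ (M.segreIdeal (d + 1 - i)).height := by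
    intro i
    have hp := M.isPrime_segreIdeal
    induction i with
    | zero =>
      intro _
      have hbot : (⊥ : Ideal (MvPowerSeries (Fin N) ℂ)).IsPrime := Ideal.isPrime_bot
      have h1 : (⊥ : Ideal (MvPowerSeries (Fin N) ℂ)) < M.segreIdeal (d + 1) := bot_lt_iff_ne_bot.2 hne
      have := Ideal.height_add_one_le_of_lt_of_isPrime h1
      refine le_trans ?_ this
      simp
    | succ i ih =>
      intro hi
      have h1 := hlt (d + 1 - (i + 1)) (by omega)
      rw [show d + 1 - (i + 1) + 1 = d + 1 - i by omega] at h1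
      refine le_trans ?_ (Ideal.height_add_one_le_of_lt_of_isPrime h1)
      have := ih (by omega)
      rw [Nat.cast_succ]
      exact add_le_add this le_rfl
  have h1 := hheight d le_rfl
  rw [show d + 1 - d = 1 by omega] at h1
  have h2 : d + 1 ≤ d := by exact_mod_cast h1.trans M.height_segreIdeal_one_le
  omega

/-- At `0` the gradients of `M₁` are those of `M` multiplied by `a(0)`; their independence makes `a`
invertible. -/
theorem ideal_eq_of_sameSubmanifold {M₁ M : GenericSubmanifold N d} (h : SameSubmanifold M₁ M) :
    M₁.ideal = M.ideal := by
  obtain ⟨a, ha⟩ := h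
  have hle : M₁.ideal ≤ M.ideal := by
    rw [ideal, Ideal.span_le]
    rintro _ ⟨j, rfl⟩
    rw [ha]
    exact M.mem_ideal_mulVec a j
  have hdet : IsUnit a.det := by
    rw [MvPowerSeries.isUnit_iff_constantCoeff, RingHom.map_det, isUnit_iff_ne_zero]
    intro h0
    obtain ⟨v, hv, hva⟩ := Matrix.exists_vecMul_eq_zero_iff.2 h0
    have hli := Fintype.linearIndependent_iff.1 M₁.generic v
    apply hv
    funext j
    refine hli ?_ j
    funext i
    rw [Finset.sum_apply, Pi.zero_apply]
    have h1 : ∀ j, constantCoeff (pderiv ℂ (Sum.inl i) (M₁.ρ j)) =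
        ∑ l, constantCoeff (a j l) * constantCoeff (pderiv ℂ (Sum.inl i) (M.ρ l)) := by
      intro j
      rw [congrFun ha j, Matrix.mulVec, dotProduct]
      simp [Derivation.leibniz, M.zero]
    simp only [Pi.smul_apply, smul_eq_mul, h1, Finset.mul_sum]
    rw [Finset.sum_comm]
    refine Finset.sum_eq_zero fun l _ => ?_
    have h2 := congrFun hva l
    simp only [Matrix.vecMul, dotProduct, RingHom.mapMatrix_apply, Matrix.map_apply,
      Pi.zero_apply] at h2
    simp only [← mul_assoc, ← Finset.sum_mul, h2, zero_mul]
  refine le_antisymm hle ?_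
  rw [ideal, Ideal.span_le]
  rintro _ ⟨j, rfl⟩
  have h1 : M.ρ = a⁻¹.mulVec M₁.ρ := by
    rw [ha, Matrix.mulVec_mulVec, Matrix.nonsing_inv_mul _ hdet, Matrix.one_mulVec]
  rw [h1]
  exact M₁.mem_ideal_mulVec _ j

theorem segreIdeal_congr {M₁ M : GenericSubmanifold N d} (h : M₁.ideal = M.ideal) (k : ℕ) :
    M₁.segreIdeal k = M.segreIdeal k := by
  induction k with
  | zero => rfl
  | succ k ih => rw [segreIdeal, segreIdeal, h, ih]

end GenericSubmanifold

/-! ### Words of operators and multi-indices. -/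

section Words

theorem exists_linearMap_applyWord {ι A : Type*} [CommRing A] [Algebra ℂ A]
    (D : ι → Derivation ℂ A A) (l : List ι) :
    ∃ Λ : A →ₗ[ℂ] A, ∀ f, applyWord (fun i f => D i f) l f = Λ f := by
  induction l with
  | nil => exact ⟨LinearMap.id, fun f => rfl⟩
  | cons i l ih =>
    obtain ⟨Λ, hΛ⟩ := ih
    exact ⟨Λ ∘ₗ (D i : A →ₗ[ℂ] A), fun f => hΛ _⟩

theorem applyWord_append_singleton {ι A : Type*} (D : ι → A → A) (l : List ι) (i : ι) (f : A) :
    applyWord D (l ++ [i]) f = D i (applyWord D l f) := by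
  simp [applyWord]

theorem applyWord_mem_filtration {ι A : Type*} {K : ℕ → Set A} (D : ι → A → A)
    (hD : ∀ i r, ∀ f ∈ K r, D i f ∈ K (r + 1)) (l : List ι) {r : ℕ} {f : A} (hf : f ∈ K r) :
    applyWord D l f ∈ K (r + l.length) := by
  induction l generalizing r f with
  | nil => exact hf
  | cons i l ih =>
    have := ih (hD i r f hf)
    rwa [add_assoc, add_comm 1] at this

/-- The composition of powers of operators along a list of indices. -/
def listPow {ι A : Type} (D : ι → A → A) (L : List ι) (α : ι → ℕ) : A → A :=
  (L.map fun i => (D i)^[α i]).foldr (fun f g => f ∘ g) id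

theorem listPow_cons {ι A : Type} (D : ι → A → A) (i : ι) (L : List ι) (α : ι → ℕ) (f : A) :
    listPow D (i :: L) α f = (D i)^[α i] (listPow D L α f) := rfl

theorem exists_linearMap_listPow {ι A : Type} [CommRing A] [Algebra ℂ A]
    (D : ι → Derivation ℂ A A) (L : List ι) (α : ι → ℕ) :
    ∃ Λ : A →ₗ[ℂ] A, ∀ f, listPow (fun i f => D i f) L α f = Λ f := by
  induction L with
  | nil => exact ⟨LinearMap.id, fun f => rfl⟩
  | cons i L ih =>
    obtain ⟨Λ, hΛ⟩ := ih
    refine ⟨((D i : A →ₗ[ℂ] A) ^ α i).comp Λ, fun f => ?_⟩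
    rw [listPow_cons, hΛ, LinearMap.comp_apply, Module.End.pow_apply]
    rfl

theorem listPow_mem_filtration {ι A : Type} {F : ℕ → Set A} (D : ι → A → A)
    (hD : ∀ i r, ∀ f ∈ F (r + 1), D i f ∈ F r) (L : List ι) (α : ι → ℕ) {r : ℕ} {f : A}
    (hf : f ∈ F (r + (L.map α).sum)) : listPow D L α f ∈ F r := by
  have hit : ∀ (i : ι) (n r : ℕ) (f : A), f ∈ F (r + n) → (D i)^[n] f ∈ F r := by
    intro i n
    induction n with
    | zero => exact fun r f hf => hf
    | succ n ih =>
      intro r f hf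
      rw [Function.iterate_succ_apply]
      exact ih r _ (hD i _ f (by rwa [add_assoc]))
  induction L generalizing r with
  | nil => exact hf
  | cons i L ih =>
    rw [listPow_cons]
    refine hit i _ r _ (ih ?_)
    rwa [List.map_cons, List.sum_cons, ← add_assoc] at hf

section Commuting

variable {ι A : Type} {D : ι → A → A}

theorem listPow_comm (hD : ∀ i j, Function.Commute (D i) (D j)) (i : ι) (L : List ι) (α : ι → ℕ)
    (f : A) : listPow D L α (D i f) = D i (listPow D L α f) := by
  induction L with
  | nil => rfl
  | cons j L ih =>
    rw [listPow_cons, listPow_cons, ih]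
    exact ((hD i j).iterate_right (α j) _).symm

theorem listPow_add_single_of_notMem [DecidableEq ι] (i : ι) (L : List ι) (hi : i ∉ L) (α : ι → ℕ) (f : A) :
    listPow D L (α + Pi.single i 1) f = listPow D L α f := by
  induction L with
  | nil => rfl
  | cons j L ih =>
    rw [List.mem_cons, not_or] at hi
    rw [listPow_cons, listPow_cons, ih hi.2, Pi.add_apply, Pi.single_eq_of_ne (Ne.symm hi.1),
      add_zero]

theorem listPow_add_single [DecidableEq ι] (hD : ∀ i j, Function.Commute (D i) (D j)) (i : ι) (L : List ι)
    (hi : i ∈ L) (hL : L.Nodup) (α : ι → ℕ) (f : A) :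
    listPow D L (α + Pi.single i 1) f = D i (listPow D L α f) := by
  induction L with
  | nil => simp at hi
  | cons j L ih =>
    rw [List.nodup_cons] at hL
    rw [listPow_cons, listPow_cons]
    by_cases hij : i = j
    · subst hij
      rw [listPow_add_single_of_notMem i L hL.1, Pi.add_apply, Pi.single_eq_same,
        Function.iterate_succ_apply']
    · rw [ih ((List.mem_cons.1 hi).resolve_left hij) hL.2, Pi.add_apply,
        Pi.single_eq_of_ne (Ne.symm hij), add_zero]
      exact ((hD i j).iterate_right (α j) _).symm

end Commuting

theorem multiPow_eq_listPow {A : Type} {n : ℕ} (D : Fin n → A → A) (α : Fin n → ℕ) :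
    multiPow D α = listPow D (List.finRange n) α := rfl

theorem pderiv_comm {σ : Type} (i j : σ) (f : MvPowerSeries σ ℂ) :
    pderiv ℂ i (pderiv ℂ j f) = pderiv ℂ j (pderiv ℂ i f) := by
  ext e
  rw [coeff_pderiv, coeff_pderiv, coeff_pderiv, coeff_pderiv, add_right_comm]
  by_cases hij : i = j
  · rw [hij]
  · simp [Finsupp.single_eq_of_ne hij, Finsupp.single_eq_of_ne (Ne.symm hij)]
    ring

/-- Partial derivatives commute, so a word depends only on its letter counts. This translates the
jet hypothesis into the language of words used by the inductions. -/
theorem exists_partialDeriv_eq_applyWord {N : ℕ} (l : List (Fin N)) :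
    ∃ α : Fin N → ℕ, ∑ i, α i = l.length ∧ ∀ f : MvPowerSeries (Fin N) ℂ,
      applyWord (fun i g => pderiv ℂ i g) l f = partialDeriv α f := by
  have hc : ∀ i j : Fin N, Function.Commute (fun g : MvPowerSeries (Fin N) ℂ => pderiv ℂ i g)
      (fun g => pderiv ℂ j g) := fun i j f => pderiv_comm i j f
  induction l with
  | nil =>
    refine ⟨0, by simp, fun f => ?_⟩
    have : ∀ L : List (Fin N), listPow (fun i g => pderiv ℂ i g) L 0 f = f := by
      intro L
      induction L with
      | nil => rfl
      | cons i L ih => rw [listPow_cons, ih]; rfl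
    exact (this _).symm
  | cons i l ih =>
    obtain ⟨α, hα, h⟩ := ih
    refine ⟨α + Pi.single i 1, by simp [Finset.sum_add_distrib, hα], fun f => ?_⟩
    rw [applyWord_cons, h, partialDeriv, partialDeriv, multiPow_eq_listPow, multiPow_eq_listPow,
      listPow_add_single hc i _ (List.mem_finRange i) (List.nodup_finRange N)]
    exact listPow_comm hc i _ α f

end Words

/-! ### Ideals generated by conjugate jets. -/

section Jets

variable {N n : ℕ}

/-- The ideal generated by the conjugates in `ζ` of the derivatives of order at most `r` of the
series `h i`. -/
def jetIdeal (h : Fin n → MvPowerSeries (Fin N) ℂ) (r : ℕ) : Ideal (Series N) :=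
  Ideal.span {f | ∃ (i : Fin n) (l : List (Fin N)), l.length ≤ r ∧
    f = antiholo N (applyWord (fun k g => pderiv ℂ k g) l (h i))}

variable {h : Fin n → MvPowerSeries (Fin N) ℂ}

theorem jetIdeal_mono {r s : ℕ} (hrs : r ≤ s) : jetIdeal h r ≤ jetIdeal h s :=
  Ideal.span_mono fun _ ⟨i, l, hl, hf⟩ => ⟨i, l, hl.trans hrs, hf⟩

/-- By the chain rule, any derivation of `ḡ(ζ)` is a combination of the conjugates of the first
derivatives of `g`. -/
theorem derivation_mem_jetIdeal (D : Derivation ℂ (Series N) (Series N)) {r : ℕ} {f : Series N}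
    (hf : f ∈ jetIdeal h r) : D f ∈ jetIdeal h (r + 1) := by
  refine derivation_mem_of_span (p := ⊥) (jetIdeal_mono (Nat.le_succ r)) D ?_ ?_
    (Ideal.mem_sup_right (S := ⊥) hf)
  · intro f hf
    rw [Ideal.mem_bot.1 hf, map_zero]
    exact Ideal.zero_mem _
  · rintro _ ⟨i, l, hl, rfl⟩
    rw [derivation_antiholo]
    refine sum_mem fun k _ => Ideal.mul_mem_left _ _ (Ideal.subset_span ⟨i, l ++ [k], ?_, ?_⟩)
    · simpa using hl
    · rw [applyWord_append_singleton]

theorem applyWord_mem_sup_jetIdeal {ι : Type*} {q : Ideal (Series N)}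
    (D : ι → Derivation ℂ (Series N) (Series N)) (hD : ∀ i, ∀ f ∈ q, D i f ∈ q) (l : List ι)
    {r : ℕ} {f : Series N} (hf : f ∈ q ⊔ jetIdeal h r) :
    applyWord (fun i f => D i f) l f ∈ q ⊔ jetIdeal h (r + l.length) := by
  refine applyWord_mem_filtration (K := fun r => (q ⊔ jetIdeal h r : Ideal (Series N)))
    (fun i f => D i f) ?_ l hf
  intro i r f hf
  obtain ⟨a, ha, b, hb, rfl⟩ := Submodule.mem_sup.1 hf
  rw [map_add]
  exact add_mem (Ideal.mem_sup_left (hD i a ha))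
    (Ideal.mem_sup_right (derivation_mem_jetIdeal (D i) hb))

end Jets

/-! ### Pullback by a formal mapping, and splitting fields by type. -/

namespace FormalMap

variable {N N' : ℕ} (H : FormalMap N N')

theorem constantCoeff_complexify (s : Fin N' ⊕ Fin N') : constantCoeff (H.complexify s) = 0 := by
  obtain j | j := s
  · exact (constantCoeff_holo _).trans (H.zero j)
  · refine (constantCoeff_antiholo (H.comp j)).trans ?_
    rw [H.zero j, map_zero]

/-- The pullback of series by `ℋ`. -/
def pullback : Series N' →ₐ[ℂ] Series N := substHom H.complexify H.constantCoeff_complexify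

theorem pullback_X (s : Fin N' ⊕ Fin N') : H.pullback (X s) = H.complexify s := substHom_X _ _ s

theorem constantCoeff_pullback_X (s : Fin N' ⊕ Fin N') : constantCoeff (H.pullback (X s)) = 0 := by
  rw [pullback_X, constantCoeff_complexify]

variable {H} {d d' : ℕ} {M : GenericSubmanifold N d} {M' : GenericSubmanifold N' d'}

theorem MapsInto.pullback_mem (hH : H.MapsInto M M') (j : Fin d') :
    H.pullback (M'.ρ j) ∈ M.ideal := by
  obtain ⟨c, hc⟩ := hH
  have h1 : H.pullback (M'.ρ j) = subst H.complexify (M'.ρ j) := by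
    rw [pullback, substHom, coe_substAlgHom]
  rw [h1, congrFun hc j]
  exact M.mem_ideal_mulVec c j

theorem tangentMap_apply (v : Fin N ⊕ Fin N → ℂ) (t : Fin N' ⊕ Fin N') :
    H.tangentMap v t = ∑ s, v s * constantCoeff (pderiv ℂ s (H.complexify t)) := by
  simp [tangentMap, Matrix.mulVec, dotProduct, mul_comm]

end FormalMap

theorem tangent_add {N d : ℕ} {M : GenericSubmanifold N d} {Y W : VectorField N}
    (hY : M.Tangent Y) (hW : M.Tangent W) : M.Tangent (Y + W) := by
  obtain ⟨a, ha⟩ := hY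
  obtain ⟨b, hb⟩ := hW
  refine ⟨a + b, ?_⟩
  rw [Matrix.add_mulVec, ← ha, ← hb]
  funext j
  simp only [toDerivation_apply, Pi.add_apply, add_mul, Finset.sum_add_distrib]

theorem tangent_smul {N d : ℕ} {M : GenericSubmanifold N d} (c : Series N) {Y : VectorField N}
    (hY : M.Tangent Y) : M.Tangent (c • Y) := by
  obtain ⟨a, ha⟩ := hY
  refine ⟨c • a, ?_⟩
  rw [Matrix.smul_mulVec, ← ha]
  funext j
  simp only [toDerivation_apply, Pi.smul_apply, smul_eq_mul, Finset.mul_sum, mul_assoc]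

theorem tangent_zero {N d : ℕ} (M : GenericSubmanifold N d) : M.Tangent 0 := by
  refine ⟨0, ?_⟩
  rw [Matrix.zero_mulVec]
  funext j
  simp [toDerivation_apply]

theorem exists_add_of_mem_distribution {N d : ℕ} {M : GenericSubmanifold N d} {Y : VectorField N}
    (hY : Y ∈ M.distribution) : ∃ V W : VectorField N, Y = V + W ∧ M.Tangent V ∧ V.IsType01 ∧
      W.IsType10 := by
  refine Submodule.span_induction (p := fun Y _ => ∃ V W : VectorField N, Y = V + W ∧
    M.Tangent V ∧ V.IsType01 ∧ W.IsType10) ?_ ?_ ?_ ?_ hY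
  · rintro Y ⟨hT, hY | hY⟩
    · exact ⟨Y, 0, (add_zero Y).symm, hT, hY, fun _ => rfl⟩
    · exact ⟨0, Y, (zero_add Y).symm, tangent_zero M, fun _ => rfl, hY⟩
  · exact ⟨0, 0, (add_zero 0).symm, tangent_zero M, fun _ => rfl, fun _ => rfl⟩
  · rintro _ _ _ _ ⟨V, W, rfl, hT, hV, hW⟩ ⟨V', W', rfl, hT', hV', hW'⟩
    exact ⟨V + V', W + W', add_add_add_comm _ _ _ _, tangent_add hT hT',
      fun i => by simp [hV i, hV' i], fun i => by simp [hW i, hW' i]⟩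
  · rintro c _ _ ⟨V, W, rfl, hT, hV, hW⟩
    exact ⟨c • V, c • W, smul_add _ _ _, tangent_smul c hT,
      fun i => by simp [hV i], fun i => by simp [hW i]⟩

/-! ### The reflection principle and finite determination. -/

section Reflection

variable {N N' d d' : ℕ} {M' : GenericSubmanifold N' d'} {M : GenericSubmanifold N d}

/-- Every `(0,1)` vector tangent to `M'` is the image of a `(0,1)` vector field tangent to `M`. -/
theorem exists_tangent_of_CRSubmersive {H : FormalMap N N'} (hH : H.CRSubmersive M M')
    {v : Fin N' ⊕ Fin N' → ℂ} (hv : ∀ i, v (Sum.inl i) = 0) (hv' : v ∈ tangentSpace M'.ρ) :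
    ∃ Y : VectorField N, M.Tangent Y ∧ Y.IsType01 ∧
      ∀ s, constantCoeff (Y.toDerivation (H.complexify s)) = v s := by
  obtain ⟨Y', hT', hY', hYv⟩ := M'.exists_tangent_type01 hv hv'
  have h1 : v ∈ M'.distributionAtZero :=
    ⟨Y', Submodule.subset_span ⟨hT', Or.inl hY'⟩, funext fun s => (hYv s).symm⟩
  rw [← hH.2] at h1
  obtain ⟨_, ⟨Y, hY, rfl⟩, hu⟩ := h1
  -- Only the `(0,1)` part `V` is kept: `W` kills the conjugate components of `ℋ`, while `V` kills
  -- the others, where `v` is zero.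
  obtain ⟨V, W, rfl, hT, hV, hW⟩ := exists_add_of_mem_distribution hY
  refine ⟨V, hT, hV, ?_⟩
  rintro (j | j)
  · have : V.toDerivation (H.complexify (Sum.inl j)) = 0 := type01_holo hV (H.comp j)
    rw [this, hv, map_zero]
  · have h2 : W.toDerivation (H.complexify (Sum.inr j)) = 0 := type10_antiholo hW (H.comp j)
    rw [← hu, FormalMap.tangentMap_apply]
    have h3 := congrArg constantCoeff h2
    rw [toDerivation_apply, map_sum, map_zero] at h3
    rw [toDerivation_apply, map_sum]
    simp only [Pi.add_apply, map_add, add_mul, Finset.sum_add_distrib, map_mul] at h3 ⊢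
    rw [h3, add_zero]

/-- The spanning condition gives relations whose coefficients at `0` form any prescribed unit
vector, so each `δ i` lies in `q` plus the maximal ideal times the `δ k`; Nakayama's lemma finishes.
-/
theorem mem_of_span_eq_top {σ : Type} [Fintype σ] {n : ℕ} {q : Ideal (MvPowerSeries σ ℂ)}
    (δ : Fin n → MvPowerSeries σ ℂ)
    (S : Set (Fin n → MvPowerSeries σ ℂ)) (hS : ∀ c ∈ S, ∑ i, c i * δ i ∈ q)
    (htop : Submodule.span ℂ ((fun c i => constantCoeff (c i)) '' S) = ⊤) (i : Fin n) :
    δ i ∈ q := by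
  classical
  have h1 : ∀ v : Fin n → ℂ, ∃ c : Fin n → MvPowerSeries σ ℂ,
      (∀ i, constantCoeff (c i) = v i) ∧ ∑ i, c i * δ i ∈ q := by
    intro v
    have hv : v ∈ Submodule.span ℂ ((fun (c : Fin n → MvPowerSeries σ ℂ) i =>
      constantCoeff (c i)) '' S) := htop ▸ Submodule.mem_top
    refine Submodule.span_induction (p := fun v _ => ∃ c : Fin n → MvPowerSeries σ ℂ,
      (∀ i, constantCoeff (c i) = v i) ∧ ∑ i, c i * δ i ∈ q) ?_ ?_ ?_ ?_ hv
    · rintro _ ⟨c, hc, rfl⟩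
      exact ⟨c, fun i => rfl, hS c hc⟩
    · exact ⟨0, fun i => by simp, by simp⟩
    · rintro _ _ _ _ ⟨c, hc, hcq⟩ ⟨c', hc', hcq'⟩
      refine ⟨c + c', fun i => by simp [hc, hc'], ?_⟩
      simp only [Pi.add_apply, add_mul, Finset.sum_add_distrib]
      exact add_mem hcq hcq'
    · rintro a _ _ ⟨c, hc, hcq⟩
      refine ⟨fun i => C a * c i, fun i => by simp [hc], ?_⟩
      simp only [mul_assoc, ← Finset.mul_sum]
      exact Ideal.mul_mem_left _ _ hcq
  have h2 : Ideal.span (Set.range δ) ≤ q := by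
    refine Submodule.le_of_le_smul_of_le_jacobson_bot (I := maximalIdeal _)
      (IsNoetherian.noetherian _) (IsLocalRing.maximalIdeal_le_jacobson _) ?_
    rw [Ideal.span_le]
    rintro _ ⟨i, rfl⟩
    obtain ⟨c, hc, hcq⟩ := h1 (Pi.single i 1)
    have h3 : δ i = ∑ k, c k * δ k + ∑ k, ((Pi.single i 1 : Fin n → MvPowerSeries σ ℂ) k - c k) *
        δ k := by
      simp only [sub_mul, Finset.sum_sub_distrib]
      rw [add_sub_cancel, Finset.sum_eq_single i]
      · simp
      · intro k _ hk
        simp [hk]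
      · simp
    rw [h3]
    refine add_mem (Ideal.mem_sup_left hcq) (Ideal.mem_sup_right (sum_mem fun k _ => ?_))
    refine Ideal.mul_mem_mul (mem_maximalIdeal_iff.2 ?_) (Ideal.subset_span ⟨k, rfl⟩)
    rw [map_sub, hc]
    by_cases hk : k = i
    · subst hk
      simp
    · simp [hk]
  exact h2 (Ideal.subset_span ⟨i, rfl⟩)

/-- The difference of the pullbacks of a series by two maps, modulo the conjugate differences. -/
theorem exists_difference_quotient (H₁ H₂ : FormalMap N N') (F : Series N') :
    ∃ A : Fin N' → Series N,
      (∀ i, A i - H₁.pullback (pderiv ℂ (Sum.inl i) F) ∈ (maximalIdeal _).map (holo N)) ∧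
      ∑ i, A i * holo N (H₁.comp i - H₂.comp i) - (H₁.pullback F - H₂.pullback F) ∈
        jetIdeal (fun i => H₁.comp i - H₂.comp i) 0 := by
  -- The intermediate point `(H₂(Z), H̄₁(ζ))` separates the change in `Z` from the change in `ζ`.
  let y : Fin N' ⊕ Fin N' → Series N :=
    Sum.elim (fun j => holo N (H₂.comp j)) fun j => antiholo N (H₁.comp j)
  have hy : ∀ s, constantCoeff (y s) = 0 := by
    rintro (j | j)
    · exact H₂.constantCoeff_complexify (Sum.inl j)
    · exact H₁.constantCoeff_complexify (Sum.inr j)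
  let k := substHom y hy
  let δ : Fin N' → Series N := fun i => holo N (H₁.comp i - H₂.comp i)
  set q := Ideal.span (Set.range δ) with hq
  have hδ : ∀ i, δ i = H₁.complexify (Sum.inl i) - y (Sum.inl i) := fun i => map_sub (holo N) _ _
  have h1 := taylor_mem (h := k) (k := H₁.pullback) (q := q) H₁.constantCoeff_pullback_X (by
    rintro (j | j)
    · rw [substHom_X, FormalMap.pullback_X, ← neg_mem_iff, neg_sub, ← hδ]
      exact Ideal.subset_span ⟨j, rfl⟩
    · rw [substHom_X, FormalMap.pullback_X]
      have : y (Sum.inr j) - H₁.complexify (Sum.inr j) = 0 := sub_self _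
      rw [this]
      exact q.zero_mem) F
  have h2 : k F - H₂.pullback F ∈ jetIdeal (fun i => H₁.comp i - H₂.comp i) 0 := by
    refine algHom_sub_mem H₂.constantCoeff_pullback_X ?_ F
    rintro (j | j)
    · rw [substHom_X, FormalMap.pullback_X]
      have : y (Sum.inl j) - H₂.complexify (Sum.inl j) = 0 := sub_self _
      rw [this]
      exact Ideal.zero_mem _
    · rw [substHom_X, FormalMap.pullback_X]
      have : y (Sum.inr j) - H₂.complexify (Sum.inr j) =
        antiholo N (H₁.comp j - H₂.comp j) := (map_sub (antiholo N) _ _).symm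
      rw [this]
      exact Ideal.subset_span ⟨j, [], by simp, rfl⟩
  -- The quadratic Taylor remainder is absorbed into the coefficients: its multipliers `e i` lie in
  -- `q`, hence in the ideal generated by `Z`.
  have h3 : ∀ x ∈ q ^ 2, ∃ e : Fin N' → Series N, (∀ i, e i ∈ q) ∧ x = ∑ i, e i * δ i := by
    intro x hx
    rw [pow_two] at hx
    refine Submodule.mul_induction_on hx ?_ ?_
    · intro a ha b hb
      obtain ⟨c, rfl⟩ := (Ideal.mem_span_range_iff_exists_fun).1 hb
      refine ⟨fun i => a * c i, fun i => Ideal.mul_mem_right _ _ ha, ?_⟩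
      rw [Finset.mul_sum]
      exact Finset.sum_congr rfl fun i _ => by ring
    · rintro _ _ ⟨e, he, rfl⟩ ⟨e', he', rfl⟩
      refine ⟨e + e', fun i => add_mem (he i) (he' i), ?_⟩
      simp [add_mul, Finset.sum_add_distrib]
  obtain ⟨e, he, hsum⟩ := h3 _ h1
  have hqZ : q ≤ (maximalIdeal _).map (holo N) := by
    rw [hq, Ideal.span_le]
    rintro _ ⟨i, rfl⟩
    refine Ideal.mem_map_of_mem _ (mem_maximalIdeal_iff.2 ?_)
    rw [map_sub, H₁.zero, H₂.zero, sub_zero]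
  refine ⟨fun i => H₁.pullback (pderiv ℂ (Sum.inl i) F) - e i, fun i => ?_, ?_⟩
  · rw [sub_sub_cancel_left]
    exact neg_mem (hqZ (he i))
  · convert neg_mem h2 using 1
    have h4 : ∑ s, H₁.pullback (pderiv ℂ s F) * (k (X s) - H₁.pullback (X s)) =
        - ∑ i, H₁.pullback (pderiv ℂ (Sum.inl i) F) * δ i := by
      rw [Fintype.sum_sum_type, ← Finset.sum_neg_distrib]
      have h5 : ∀ j, k (X (Sum.inr j)) - H₁.pullback (X (Sum.inr j)) = 0 := by
        intro j
        rw [substHom_X, FormalMap.pullback_X]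
        exact sub_self _
      simp only [h5, mul_zero, Finset.sum_const_zero, add_zero]
      refine Finset.sum_congr rfl fun i _ => ?_
      rw [hδ, substHom_X, FormalMap.pullback_X]
      ring
    rw [h4] at hsum
    change ∑ i, (H₁.pullback (pderiv ℂ (Sum.inl i) F) - e i) * δ i - _ = _
    simp only [sub_mul, Finset.sum_sub_distrib]
    rw [← hsum]
    ring

/-- The `ℓ`-nondegeneracy of `M'`, expressed by the pullbacks of the gradients of its defining
series. -/
theorem span_applyWord_eq_top {H : FormalMap N N'} (hH : H.MapsInto M M') {l₀ : ℕ}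
    (hM' : M'.Nondegenerate l₀)
    (Y : tangentSpace (Sum.elim (fun i : Fin N' => (X (Sum.inl i) : Series N')) M'.ρ) →
      VectorField N)
    (hT : ∀ v, M.Tangent (Y v)) (hY01 : ∀ v, (Y v).IsType01)
    (hYv : ∀ v s, constantCoeff ((Y v).toDerivation (H.complexify s)) =
      (v : Fin N' ⊕ Fin N' → ℂ) s)
    (A : Fin d' → Fin N' → Series N)
    (hA : ∀ j i, A j i - H.pullback (pderiv ℂ (Sum.inl i) (M'.ρ j)) ∈
      (maximalIdeal _).map (holo N)) :
    Submodule.span ℂ ((fun c i => constantCoeff (c i)) ''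
      {c : Fin N' → Series N | ∃ j l, List.length l ≤ l₀ ∧
        c = fun i => applyWord (fun v f => (Y v).toDerivation f) l (A j i)}) = ⊤ := by
  classical
  -- A proper span is killed by a nonzero functional `φ`; the goal is that `φ` then kills the
  -- gradient span of `M'` as well.
  by_contra hne
  obtain ⟨φ, hφ, hle⟩ := Submodule.exists_le_ker_of_lt_top _ (lt_top_iff_ne_top.2 hne)
  let a : Fin N' → ℂ := fun i => φ (Pi.single i 1)
  have hφa : ∀ v, φ v = ∑ i, a i * v i := by
    intro v
    rw [LinearMap.pi_apply_eq_sum_univ φ]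
    refine Finset.sum_congr rfl fun i _ => ?_
    rw [smul_eq_mul, mul_comm]
    congr 2
    funext k
    simp [Pi.single_apply, eq_comm]
  obtain ⟨L, hL, hleast⟩ := hM'
  -- The tangent space of these equations consists of the `(0,1)` vectors tangent to `M'` at `0`.
  let w : Fin N' ⊕ Fin d' → Series N' :=
    Sum.elim (fun i : Fin N' => (X (Sum.inl i) : Series N')) M'.ρ
  have hw : ∀ s, constantCoeff (w s) = 0 := by
    rintro (i | j)
    · simp [w]
    · exact M'.zero j
  let zI := (maximalIdeal (MvPowerSeries (Fin N) ℂ)).map (holo N)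
  have hzI : zI ≤ maximalIdeal (Series N) := by
    rw [Ideal.map_le_iff_le_comap]
    intro f hf
    rw [Ideal.mem_comap, mem_maximalIdeal_iff, constantCoeff_holo]
    exact mem_maximalIdeal_iff.1 hf
  have hDz : ∀ v, ∀ f ∈ zI, (Y v).toDerivation f ∈ zI := by
    intro v f hf
    refine derivation_mem_of_span (p := ⊥) le_rfl _ ?_ ?_ (Ideal.mem_sup_right (S := ⊥) hf)
    · intro f hf
      rw [Ideal.mem_bot.1 hf, map_zero]
      exact zI.zero_mem
    · rintro _ ⟨g, _, rfl⟩
      have h0 : (Y v).toDerivation (holo N g) = 0 := type01_holo (hY01 v) g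
      exact h0 ▸ zI.zero_mem
  let B : Fin d' → Series N' := fun j => ∑ i, C (a i) * pderiv ℂ (Sum.inl i) (M'.ρ j)
  have hB : ∀ j, B j ∈ Ideal.span (Set.range w) ⊔ maximalIdeal (Series N') ^ (l₀ + 1) := by
    intro j
    refine mem_sup_of_applyWord (h := H.pullback) hw H.constantCoeff_pullback_X
      (fun v => (Y v).toDerivation) (fun v s => by rw [H.pullback_X, hYv]) (M.ideal ⊔ zI)
      (sup_le M.ideal_le_maximalIdeal hzI) ?_ ?_ (l₀ + 1) ?_
    · intro v f hf
      obtain ⟨b, hb, c, hc, rfl⟩ := Submodule.mem_sup.1 hf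
      rw [map_add]
      exact add_mem (Ideal.mem_sup_left ((hT v).mem_ideal hb)) (Ideal.mem_sup_right (hDz v c hc))
    · rintro (i | j)
      · refine Ideal.mem_sup_right ?_
        change H.pullback (X (Sum.inl i)) ∈ zI
        rw [H.pullback_X]
        exact Ideal.mem_map_of_mem (holo N) (mem_maximalIdeal_iff.2 (H.zero i))
      · exact Ideal.mem_sup_left (hH.pullback_mem j)
    · intro l hl
      obtain ⟨Λ, hΛ⟩ := exists_linearMap_applyWord (fun v => (Y v).toDerivation) l
      -- `A` may replace the pulled-back gradient: they differ by an element of the ideal generated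
      -- by `Z`, which `(0,1)` fields preserve.
      have h1 : ∑ i, a i • A j i - H.pullback (B j) ∈ zI := by
        have : H.pullback (B j) =
            ∑ i, a i • H.pullback (pderiv ℂ (Sum.inl i) (M'.ρ j)) := by
          simp only [B, map_sum, map_mul, algHom_C, smul_eq_C_mul]
        rw [this, ← Finset.sum_sub_distrib]
        refine sum_mem fun i _ => ?_
        rw [← smul_sub, smul_eq_C_mul]
        exact Ideal.mul_mem_left _ _ (hA j i)
      have h2 := mem_maximalIdeal_iff.1 (hzI (applyWord_mem (fun v => (Y v).toDerivation) l
        (fun v _ => hDz v) h1))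
      rw [hΛ, map_sub, map_sub, sub_eq_zero] at h2
      rw [hΛ, ← h2, map_sum, map_sum]
      have h3 := hle (Submodule.subset_span ⟨_, ⟨j, l, by omega, rfl⟩, rfl⟩)
      rw [LinearMap.mem_ker, hφa] at h3
      simpa [hΛ] using h3
  -- Each `L k` preserves the ideal of `w` and lowers the order by at most one, so `hB` leaves order
  -- one after `l₀` applications. This frees the argument from the choice of `L`.
  have hker : M'.gradientSpan L l₀ ≤ LinearMap.ker φ := by
    rw [GenericSubmanifold.gradientSpan, Submodule.span_le]
    rintro _ ⟨j, α, hα, rfl⟩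
    rw [SetLike.mem_coe, LinearMap.mem_ker, hφa]
    obtain ⟨Λ, hΛ⟩ := exists_linearMap_listPow (fun k => (L k).toDerivation)
      (List.finRange (N' - d')) α
    have h1 : listPow (fun k f => (L k).toDerivation f) (List.finRange (N' - d')) α (B j) ∈
        Ideal.span (Set.range w) ⊔ maximalIdeal (Series N') ^ 1 := by
      refine listPow_mem_filtration
        (F := fun r => (Ideal.span (Set.range w) ⊔ maximalIdeal (Series N') ^ r :
          Ideal (Series N'))) (fun k f => (L k).toDerivation f) ?_ _ α ?_
      · intro k r f hf
        obtain ⟨b, hb, c, hc, rfl⟩ := Submodule.mem_sup.1 hf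
        rw [map_add]
        refine add_mem (Ideal.mem_sup_left ?_)
          (Ideal.mem_sup_right (derivation_apply_mem_pow _ _ _ hc))
        refine derivation_mem_of_span (p := ⊥) le_rfl _ ?_ ?_ (Ideal.mem_sup_right (S := ⊥) hb)
        · intro f hf
          rw [Ideal.mem_bot.1 hf, map_zero]
          exact Ideal.zero_mem _
        · rintro _ ⟨i | j, rfl⟩
          · have h0 : (L k).toDerivation (w (Sum.inl i)) = 0 := by
              simp only [w, Sum.elim_inl]
              rw [toDerivation_X, hL.type01 k i]
            rw [h0]
            exact Ideal.zero_mem _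
          · have h2 : M'.ideal ≤ Ideal.span (Set.range w) := by
              rw [GenericSubmanifold.ideal, Ideal.span_le]
              rintro _ ⟨j, rfl⟩
              exact Ideal.subset_span ⟨Sum.inr j, rfl⟩
            exact h2 ((hL.tangent k).mem_ideal (M'.rho_mem_ideal j))
      · have h2 : ((List.finRange (N' - d')).map α).sum ≤ l₀ := by
          rwa [← Fin.sum_univ_def]
        have h3 : Ideal.span (Set.range w) ⊔ maximalIdeal (Series N') ^ (l₀ + 1) ≤
            Ideal.span (Set.range w) ⊔ maximalIdeal (Series N') ^
              (1 + ((List.finRange (N' - d')).map α).sum) :=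
          sup_le_sup le_rfl (Ideal.pow_le_pow_right (by omega))
        exact h3 (hB j)
    have h2 : constantCoeff (Λ (B j)) = 0 := by
      rw [← hΛ, ← mem_maximalIdeal_iff]
      refine (sup_le ?_ (pow_one (maximalIdeal (Series N'))).le) h1
      rw [Ideal.span_le]
      rintro _ ⟨s, rfl⟩
      exact mem_maximalIdeal_iff.2 (hw s)
    simp only [B, ← smul_eq_C_mul, map_sum, map_smul] at h2
    simpa [multiPow_eq_listPow, hΛ] using h2
  rw [hleast.1, top_le_iff, LinearMap.ker_eq_top] at hker
  exact hφ hker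

/-- The reflection principle: on `M`, the difference of two maps is controlled by the
`ℓ₀`-jet of its conjugate. -/
theorem holo_sub_mem {H₁ H₂ : FormalMap N N'} (h₁ : H₁.CRSubmersive M M')
    (h₂ : H₂.MapsInto M M') {l₀ : ℕ} (hM' : M'.Nondegenerate l₀) (i : Fin N') :
    holo N (H₁.comp i - H₂.comp i) ∈
      M.ideal ⊔ jetIdeal (fun i => H₁.comp i - H₂.comp i) l₀ := by
  have hex : ∀ v : tangentSpace (Sum.elim (fun i : Fin N' => (X (Sum.inl i) : Series N')) M'.ρ),
      ∃ Y : VectorField N, M.Tangent Y ∧ Y.IsType01 ∧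
        ∀ s, constantCoeff (Y.toDerivation (H₁.complexify s)) =
          (v : Fin N' ⊕ Fin N' → ℂ) s := by
    rintro ⟨v, hv⟩
    refine exists_tangent_of_CRSubmersive h₁ (fun i => ?_) fun j => hv (Sum.inr j)
    have h1 := hv (Sum.inl i)
    rw [Sum.elim_inl, Finset.sum_eq_single (Sum.inl i)] at h1
    · simpa [pderiv_X_self] using h1
    · intro t _ ht
      rw [pderiv_X_of_ne ht.symm, map_zero, mul_zero]
    · simp
  choose Y hT hY01 hYv using hex
  choose A hA hsum using fun j => exists_difference_quotient H₁ H₂ (M'.ρ j)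
  refine mem_of_span_eq_top (fun i => holo N (H₁.comp i - H₂.comp i)) _ ?_
    (span_applyWord_eq_top h₁.1 hM' Y hT hY01 hYv A hA) i
  rintro _ ⟨j, l, hl, rfl⟩
  have h1 : ∑ i, A j i * holo N (H₁.comp i - H₂.comp i) ∈
      M.ideal ⊔ jetIdeal (fun i => H₁.comp i - H₂.comp i) 0 := by
    have := add_mem (Ideal.mem_sup_left (sub_mem (h₁.1.pullback_mem j) (h₂.pullback_mem j)))
      (Ideal.mem_sup_right (S := M.ideal) (hsum j))
    rwa [add_sub_cancel] at this
  have h2 := applyWord_mem_sup_jetIdeal (fun v => (Y v).toDerivation)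
    (fun v f hf => (hT v).mem_ideal hf) l h1
  have h3 : applyWord (fun v f => (Y v).toDerivation f) l
      (∑ i, A j i * holo N (H₁.comp i - H₂.comp i)) =
      ∑ i, applyWord (fun v f => (Y v).toDerivation f) l (A j i) *
        holo N (H₁.comp i - H₂.comp i) := by
    -- Fields of type `(0,1)` are linear over functions of `Z`, so differentiating the relation
    -- changes only its coefficients.
    have h4 : ∀ (l : List _) (f : Series N) (g : MvPowerSeries (Fin N) ℂ),
        applyWord (fun v f => (Y v).toDerivation f) l (f * holo N g) =
          applyWord (fun v f => (Y v).toDerivation f) l f * holo N g := by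
      intro l
      induction l with
      | nil => exact fun f g => rfl
      | cons v l ih =>
        intro f g
        rw [applyWord_cons, applyWord_cons, ← ih, Derivation.leibniz, type01_holo (hY01 v),
          smul_zero, zero_add, smul_eq_mul, mul_comm]
    obtain ⟨Λ, hΛ⟩ := exists_linearMap_applyWord (fun v => (Y v).toDerivation) l
    simp only [← h4]
    rw [hΛ, map_sum]
    exact Finset.sum_congr rfl fun i _ => (hΛ _).symm
  rw [h3] at h2
  exact sup_le_sup le_rfl (jetIdeal_mono (by omega)) h2

/-- Passing from one Segre ideal to the next spends `l₀` derivatives on reflection; the tangent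
lifts of `∂/∂Z_i` carry the remaining ones. -/
theorem applyWord_pderiv_mem_segreIdeal {H₁ H₂ : FormalMap N N'} (h₁ : H₁.CRSubmersive M M')
    (h₂ : H₂.MapsInto M M') {l₀ : ℕ} (hM' : M'.Nondegenerate l₀) {k₀ : ℕ}
    (hjet : ∀ (i : Fin N') (l : List (Fin N)), l.length ≤ k₀ * l₀ →
      constantCoeff (applyWord (fun k g => pderiv ℂ k g) l (H₁.comp i - H₂.comp i)) = 0)
    (k : ℕ) (hk : k ≤ k₀) (i : Fin N') (l : List (Fin N)) (hl : l.length ≤ (k₀ - k) * l₀) :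
    applyWord (fun k g => pderiv ℂ k g) l (H₁.comp i - H₂.comp i) ∈ M.segreIdeal k := by
  induction k generalizing i l with
  | zero => exact mem_maximalIdeal_iff.2 (hjet i l (by simpa using hl))
  | succ k ih =>
    rw [GenericSubmanifold.mem_segreIdeal_succ]
    choose T hT hTf using M.exists_tangent_lift
    have h1 : ∀ (l : List (Fin N)) (f : MvPowerSeries (Fin N) ℂ),
        holo N (applyWord (fun k g => pderiv ℂ k g) l f) =
          applyWord (fun k g => (T k).toDerivation g) l (holo N f) := by
      intro l
      induction l with
      | nil => exact fun f => rfl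
      | cons i l ih => exact fun f => by rw [applyWord_cons, applyWord_cons, hTf, ih]
    rw [h1]
    refine (sup_le_sup le_rfl ?_ : M.ideal ⊔ jetIdeal (fun i => H₁.comp i - H₂.comp i)
      (l₀ + l.length) ≤ _) (applyWord_mem_sup_jetIdeal (fun k => (T k).toDerivation)
        (fun k f hf => (hT k).mem_ideal hf) l (holo_sub_mem h₁ h₂ hM' i))
    rw [jetIdeal, Ideal.span_le]
    rintro _ ⟨i', l', hl', rfl⟩
    refine Ideal.mem_map_of_mem _ (ih (by omega) i' l' ?_)
    have h2 : k₀ - k = (k₀ - (k + 1)) + 1 := by omega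
    rw [h2, add_mul, one_mul]
    omega

/-- Finite determination: maps that agree to order `(d + 1) ℓ₀` at `0` coincide. -/
theorem FormalMap.eq_of_jet_eq (hM : M.segreIdeal (d + 1) = ⊥) {l₀ : ℕ}
    (hM' : M'.Nondegenerate l₀)
    {H₁ H₂ : FormalMap N N'} (h₁ : H₁.CRSubmersive M M') (h₂ : H₂.MapsInto M M')
    (hjet : ∀ (j : Fin N') (α : Fin N → ℕ), ∑ i, α i ≤ (d + 1) * l₀ →
      constantCoeff (partialDeriv α (H₁.comp j)) = constantCoeff (partialDeriv α (H₂.comp j))) :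
    H₁ = H₂ := by
  ext1
  funext j
  -- At `k = k₀ = d + 1` no derivatives are left in the budget, and the empty word gives the
  -- difference itself.
  have h := applyWord_pderiv_mem_segreIdeal h₁ h₂ hM' (k₀ := d + 1) (fun i l hl => by
    obtain ⟨α, hα, h⟩ := exists_partialDeriv_eq_applyWord l
    obtain ⟨Λ, hΛ⟩ := exists_linearMap_applyWord (fun k : Fin N => pderiv ℂ k) l
    rw [hΛ, map_sub, map_sub, sub_eq_zero, ← hΛ, ← hΛ, h, h]
    exact hjet i α (by omega)) (d + 1) le_rfl j [] (by simp)
  rw [hM, Ideal.mem_bot, applyWord_nil, sub_eq_zero] at h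
  exact h

end Reflection

end FormalCR

end

/-- The integer `k₀` depends only on the formal submanifold `M`: it is the same for all the
defining series of `M`, all targets `M'`, and all `ℓ₀`. -/
theorem theorem2p1p1 {N d : ℕ} (hd : 1 ≤ d) (M : FormalCR.GenericSubmanifold N d)
    (hM : M.FiniteType) :
    ∃ k₀ : ℕ, 1 < k₀ ∧ k₀ ≤ d + 1 ∧
      ∀ M₁ : FormalCR.GenericSubmanifold N d, FormalCR.SameSubmanifold M₁ M →
      ∀ (N' d' : ℕ) (M' : FormalCR.GenericSubmanifold N' d') (l₀ : ℕ), M'.Nondegenerate l₀ →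
      ∀ H₁ H₂ : FormalCR.FormalMap N N', H₁.CRSubmersive M₁ M' → H₂.CRSubmersive M₁ M' →
        (∀ (j : Fin N') (α : Fin N → ℕ), ∑ i, α i ≤ k₀ * l₀ →
          MvPowerSeries.constantCoeff (FormalCR.partialDeriv α (H₁.comp j)) =
            MvPowerSeries.constantCoeff (FormalCR.partialDeriv α (H₂.comp j))) →
        H₁ = H₂ := by
  -- The largest admissible value is taken; `1 < d + 1` is where `hd` enters.
  refine ⟨d + 1, by omega, le_rfl, ?_⟩
  intro M₁ hM₁ N' d' M' l₀ hM' H₁ H₂ h₁ h₂ hjet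
  -- The Segre ideals depend only on the ideal of the submanifold, so finite type of `M` serves
  -- every choice of defining series.
  have hbot : M₁.segreIdeal (d + 1) = ⊥ := by
    rw [FormalCR.GenericSubmanifold.segreIdeal_congr
      (FormalCR.GenericSubmanifold.ideal_eq_of_sameSubmanifold hM₁), M.segreIdeal_eq_bot hM]
  exact FormalCR.FormalMap.eq_of_jet_eq hbot hM' h₁ h₂.1 hjet
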